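/- Let $n\ge 0$ and $l>0$ be integers, let $V$ be a complex vector space of finite dimension $c$, and let $W$ be a complex vector space of dimension $1$. An ADHM datum is a tuple $X=(B_0,\dots,B_{n-1},I)$ in $\mathbb{B}=\mathrm{End}(V)^{\oplus n}\oplus\mathrm{Hom}(W,V)$. It is called stable if there is no proper subspace $S\subsetneq V$ with $B_i(S)\subset S$ for all $i$ and $I(W)\subset S$. Let $\mathcal{V}(n,c)\subset\mathbb{B}$ be the closed subvariety of the data with $B_iB_j=B_jB_i$ for all $i,j$, let $\Gamma(\mathcal{V}(n,c))$ be its ring of regular functions (the restrictions of the polynomial functions on $\mathbb{B}$), and let $\mathcal{V}(n,c)^{\mathrm{st}}$ be its subset of stable data. The group $G=GL(V)$ acts on $\mathcal{V}(n,c)$ by $g\cdot(B_i,I)=(gB_ig^{-1},gI)$, preserving $\mathcal{V}(n,c)^{\mathrm{st}}$. Put $\chi(g)=(\det g)^l$ and let $G$ act on $\mathcal{V}(n,c)\times\mathbb{C}$ by $g\cdot(X,z)=(g\cdot X,\chi(g)^{-1}z)$. Let $$\mathcal{M}(n,c)=\mathcal{V}(n,c)/\!/_\chi G=\mathrm{Proj}\Big(\bigoplus_{i\ge0}\Gamma(\mathcal{V}(n,c))^{G,\chi^i}\Big),\qquad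 \Gamma(\mathcal{V}(n,c))^{G,\chi^i}=\{f : f(g\cdot X)=\chi(g)^{i}f(X)\ \text{for all } g\in G,\ X\in\mathcal{V}(n,c)\}.$$ (1) For every $X\in\mathcal{V}(n,c)$ and every $z\in\mathbb{C}$ with $z\ne0$, the orbit $G\cdot(X,z)$ is Zariski closed in $\mathcal{V}(n,c)\times\mathbb{C}$ if and only if $X$ is stable. (2) $\mathcal{M}(n,c)=\mathcal{V}(n,c)^{\mathrm{st}}/G$ in the following sense. Sending $X$ to the homogeneous prime ideal of those $\sum_i f_i$ with $f_i\in\Gamma(\mathcal{V}(n,c))^{G,\chi^i}$ and $f_i(X)=0$ for all $i$ induces a homeomorphism from the orbit space $\mathcal{V}(n,c)^{\mathrm{st}}/G$, with the quotient of the Zariski topology, onto the set of closed points of $\mathcal{M}(n,c)$. Moreover, for every open $U\subset\mathcal{M}(n,c)$, evaluating sections at the images of stable data (a section that is locally a fraction $a/b$ takes the value $a(X)/b(X)$ at $X$) identifies the sections of the structure sheaf over $U$ with the $G$-invariant functions on the preimage of $U$ in $\mathcal{V}(n,c)^{\mathrm{st}}$ that are regular, i.e. locally quotients of elements of $\Gamma(\mathcal{V}(n,c))$.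 -/

import Mathlib

open AlgebraicGeometry CategoryTheory DirectSum TopologicalSpace

noncomputable section

namespace ADHM

/-! ### Regular functions and the Zariski topology -/

/-- For a subset `Y` of a finite-dimensional complex vector space `E`, with inclusion `ι : Y → E`,
the ring of regular functions on `Y`: the restrictions to `Y` of the polynomial functions on `E`,
that is, the algebra of functions generated by the restrictions of the linear forms. -/
def regularFunctions {Y E : Type*} [AddCommGroup E] [Module ℂ E] (ι : Y → E) :
    Subalgebra ℂ (Y → ℂ) :=
  Algebra.adjoin ℂ (Set.range fun φ : Module.Dual ℂ E => fun y : Y => φ (ι y))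

/-- The Zariski topology on `Y ⊆ E`: the closed sets are the common zero sets of families of
regular functions. -/
@[reducible]
def zariskiTopology {Y E : Type*} [AddCommGroup E] [Module ℂ E] (ι : Y → E) :
    TopologicalSpace Y :=
  generateFrom {U | ∃ f ∈ regularFunctions ι, U = {y | f y ≠ 0}}

/-! ### ADHM data -/

/-- The space `End(V)^n ⊕ Hom(W, V)` of ADHM data `X = (B₀, …, B_{n-1}, I)`. -/
def Datum (n : ℕ) (V W : Type*) [AddCommGroup V] [Module ℂ V] [AddCommGroup W] [Module ℂ W] :
    Type _ :=
  (Fin n → Module.End ℂ V) × (W →ₗ[ℂ] V)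

section

variable {n : ℕ} {V W : Type*} [AddCommGroup V] [Module ℂ V] [AddCommGroup W] [Module ℂ W]

instance : AddCommGroup (Datum n V W) :=
  inferInstanceAs (AddCommGroup ((Fin n → Module.End ℂ V) × (W →ₗ[ℂ] V)))

instance : Module ℂ (Datum n V W) :=
  inferInstanceAs (Module ℂ ((Fin n → Module.End ℂ V) × (W →ₗ[ℂ] V)))

/-- The operators `B₀, …, B_{n-1}` of a datum. -/
def Datum.B (X : Datum n V W) : Fin n → Module.End ℂ V := X.1

/-- The map `I : W → V` of a datum. -/
def Datum.I (X : Datum n V W) : W →ₗ[ℂ] V := X.2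

/-- A datum is stable if no proper subspace `S ⊊ V` contains `I(W)` and all `B_i(S)`. -/
def Datum.IsStable (X : Datum n V W) : Prop :=
  ¬ ∃ S : Submodule ℂ V, S ≠ ⊤ ∧ (∀ i, S.map (X.B i) ≤ S) ∧ LinearMap.range X.I ≤ S

/-- `g · (B₀, …, B_{n-1}, I) = (g B₀ g⁻¹, …, g B_{n-1} g⁻¹, g I)`. -/
instance : MulAction (LinearMap.GeneralLinearGroup ℂ V) (Datum n V W) where
  smul g X := (fun i => (g : Module.End ℂ V) * X.B i * ((g⁻¹ : (Module.End ℂ V)ˣ) : Module.End ℂ V),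
    (g : Module.End ℂ V) ∘ₗ X.I)
  one_smul X := by
    refine Prod.ext (funext fun i => ?_) ?_
    · change (1 : Module.End ℂ V) * X.1 i * _ = X.1 i
      simp
    · rfl
  mul_smul g h X := by
    refine Prod.ext (funext fun i => ?_) ?_
    · change ((g * h : (Module.End ℂ V)ˣ) : Module.End ℂ V) * X.1 i *
          (((g * h)⁻¹ : (Module.End ℂ V)ˣ) : Module.End ℂ V) = _ * (_ * X.1 i * _) * _
      simp only [mul_inv_rev, Units.val_mul, mul_assoc]
    · rfl

theorem Datum.smul_B (g : LinearMap.GeneralLinearGroup ℂ V) (X : Datum n V W) (i : Fin n) :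
    (g • X).B i =
      (g : Module.End ℂ V) * X.B i * ((g⁻¹ : (Module.End ℂ V)ˣ) : Module.End ℂ V) := rfl

theorem Datum.smul_I (g : LinearMap.GeneralLinearGroup ℂ V) (X : Datum n V W) :
    (g • X).I = (g : Module.End ℂ V) ∘ₗ X.I := rfl

theorem Datum.IsStable.smul {X : Datum n V W} (hX : X.IsStable)
    (g : LinearMap.GeneralLinearGroup ℂ V) : (g • X).IsStable := by
  rintro ⟨S, hS, hB, hI⟩
  have hgg : ∀ v : V, ((g⁻¹ : (Module.End ℂ V)ˣ) : Module.End ℂ V) ((g : Module.End ℂ V) v) = v :=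
    fun v => by rw [← Module.End.mul_apply, Units.inv_mul, Module.End.one_apply]
  have hgg' : ∀ v : V, (g : Module.End ℂ V) (((g⁻¹ : (Module.End ℂ V)ˣ) : Module.End ℂ V) v) = v :=
    fun v => by rw [← Module.End.mul_apply, Units.mul_inv, Module.End.one_apply]
  refine hX ⟨S.comap (g : Module.End ℂ V), fun h => hS ?_, fun i => ?_, ?_⟩
  · refine (Submodule.eq_top_iff').2 fun v => ?_
    have : ((g⁻¹ : (Module.End ℂ V)ˣ) : Module.End ℂ V) v ∈ S.comap (g : Module.End ℂ V) := by
      rw [h]; trivial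
    simpa [hgg'] using this
  · rintro _ ⟨v, hv, rfl⟩
    have := hB i ⟨_, hv, rfl⟩
    rw [Datum.smul_B, Module.End.mul_apply, Module.End.mul_apply, hgg] at this
    exact this
  · rintro _ ⟨w, rfl⟩
    exact hI ⟨w, rfl⟩

end

/-- The variety `𝒱(n, c)` of ADHM data: those whose operators commute pairwise. -/
def Variety (n : ℕ) (V W : Type*) [AddCommGroup V] [Module ℂ V] [AddCommGroup W] [Module ℂ W] :
    Type _ :=
  {X : Datum n V W // ∀ i j, X.B i * X.B j = X.B j * X.B i}

section

variable {n : ℕ} {V W : Type*} [AddCommGroup V] [Module ℂ V] [AddCommGroup W] [Module ℂ W]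

/-- The inclusion of the variety of ADHM data into the space of all data. -/
def Variety.toDatum (X : Variety n V W) : Datum n V W := X.1

instance : MulAction (LinearMap.GeneralLinearGroup ℂ V) (Variety n V W) where
  smul g X := ⟨g • X.1, fun i j => by
    have h : ∀ A C : Module.End ℂ V,
        (g : Module.End ℂ V) * A * ((g⁻¹ : (Module.End ℂ V)ˣ) : Module.End ℂ V) *
          ((g : Module.End ℂ V) * C * ((g⁻¹ : (Module.End ℂ V)ˣ) : Module.End ℂ V)) =
        (g : Module.End ℂ V) * (A * C) * ((g⁻¹ : (Module.End ℂ V)ˣ) : Module.End ℂ V) :=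
      fun A C => by simp only [mul_assoc, Units.inv_mul_cancel_left]
    rw [Datum.smul_B, Datum.smul_B, h, h, X.2 i j]⟩
  one_smul X := Subtype.ext (one_smul _ X.1)
  mul_smul g h X := Subtype.ext (mul_smul g h X.1)

instance : TopologicalSpace (Variety n V W) := zariskiTopology Variety.toDatum

end

/-- The stable locus `𝒱(n, c)^st`, with the topology induced from `𝒱(n, c)`. -/
abbrev StableLocus (n : ℕ) (V W : Type*) [AddCommGroup V] [Module ℂ V] [AddCommGroup W]
    [Module ℂ W] : Type _ :=
  {X : Variety n V W // X.toDatum.IsStable}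

instance {n : ℕ} {V W : Type*} [AddCommGroup V] [Module ℂ V] [AddCommGroup W] [Module ℂ W] :
    MulAction (LinearMap.GeneralLinearGroup ℂ V) (StableLocus n V W) where
  smul g X := ⟨g • X.1, X.2.smul g⟩
  one_smul X := Subtype.ext (one_smul _ X.1)
  mul_smul g h X := Subtype.ext (mul_smul g h X.1)

/-! ### The linearization -/

/-- The character `χ(g) = (det g)^l`. -/
def character (l : ℕ) (V : Type*) [AddCommGroup V] [Module ℂ V] :
    LinearMap.GeneralLinearGroup ℂ V →* ℂˣ :=
  (Units.map (LinearMap.det : Module.End ℂ V →* ℂ)) ^ l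

/-- The variety `𝒱(n, c) × ℂ`, on which `GL(V)` acts through the linearization given by
`χ = det ^ l`. -/
structure Linearized (n l : ℕ) (V W : Type*) [AddCommGroup V] [Module ℂ V] [AddCommGroup W]
    [Module ℂ W] where
  /-- the ADHM datum -/
  datum : Variety n V W
  /-- the coordinate in `ℂ` -/
  coord : ℂ

section

variable {n l : ℕ} {V W : Type*} [AddCommGroup V] [Module ℂ V] [AddCommGroup W] [Module ℂ W]

/-- `g · (X, z) = (g · X, χ(g)⁻¹ z)`. -/
instance : MulAction (LinearMap.GeneralLinearGroup ℂ V) (Linearized n l V W) where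
  smul g P := ⟨g • P.datum, (((character l V g)⁻¹ : ℂˣ) : ℂ) * P.coord⟩
  one_smul P := by
    change Linearized.mk ((1 : LinearMap.GeneralLinearGroup ℂ V) • P.datum)
      ((((character l V 1)⁻¹ : ℂˣ) : ℂ) * P.coord) = P
    simp
  mul_smul g h P := by
    change Linearized.mk ((g * h) • P.datum) ((((character l V (g * h))⁻¹ : ℂˣ) : ℂ) * P.coord) =
      Linearized.mk (g • h • P.datum) ((((character l V g)⁻¹ : ℂˣ) : ℂ) *
        ((((character l V h)⁻¹ : ℂˣ) : ℂ) * P.coord))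
    rw [mul_smul, map_mul, mul_inv, Units.val_mul, mul_assoc]

/-- The Zariski topology of `𝒱(n, c) × ℂ`, a subset of the vector space of pairs
(ADHM datum, number). -/
instance : TopologicalSpace (Linearized n l V W) :=
  zariskiTopology fun P => ((P.datum.toDatum, P.coord) : Datum n V W × ℂ)

end

/-! ### The GIT quotient -/

section

variable (n l : ℕ) (V W : Type*) [AddCommGroup V] [Module ℂ V] [AddCommGroup W] [Module ℂ W]

/-- The ring `Γ(𝒱(n, c))` of regular functions on the variety of ADHM data. -/
def Gam : Type _ := regularFunctions (Variety.toDatum : Variety n V W → Datum n V W)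

instance : CommRing (Gam n V W) :=
  inferInstanceAs (CommRing (regularFunctions (Variety.toDatum : Variety n V W → Datum n V W)))

instance : Algebra ℂ (Gam n V W) :=
  inferInstanceAs (Algebra ℂ (regularFunctions (Variety.toDatum : Variety n V W → Datum n V W)))

instance : CoeFun (Gam n V W) fun _ => Variety n V W → ℂ := ⟨fun f => f.1⟩

/-- The semi-invariants of weight `χ^i`: the regular functions `f` with
`f(g · X) = χ(g)^i f(X)`. -/
def semiInvariants (i : ℕ) : Submodule ℂ (Gam n V W) where
  carrier := {f | ∀ (g : LinearMap.GeneralLinearGroup ℂ V) (X : Variety n V W),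
    f (g • X) = (character l V g : ℂ) ^ i * f X}
  add_mem' {f f'} hf hf' g X := by
    change f.1 (g • X) + f'.1 (g • X) = _ * (f.1 X + f'.1 X)
    rw [hf, hf', mul_add]
  zero_mem' g X := by
    change (0 : ℂ) = _ * (0 : ℂ)
    rw [mul_zero]
  smul_mem' a f hf g X := by
    change a * f.1 (g • X) = _ * (a * f.1 X)
    rw [hf, mul_left_comm]

instance : SetLike.GradedMonoid (semiInvariants n l V W) where
  one_mem g X := by
    change (1 : ℂ) = _ ^ 0 * (1 : ℂ)
    rw [pow_zero, one_mul]
  mul_mem i j f f' hf hf' g X := by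
    change f.1 (g • X) * f'.1 (g • X) = _ * (f.1 X * f'.1 X)
    rw [hf, hf', pow_add, mul_mul_mul_comm]

/-- The graded ring `⨁_{i ≥ 0} Γ(𝒱(n, c))^{G, χ^i}`, realized as the ring of polynomials
`∑ f_i z^i` in one variable `z` whose `i`-th coefficient is a semi-invariant of weight `χ^i`
(the variable `z` records the degree, so that the sum is direct). -/
def SemiInvariantRing : Subalgebra ℂ (Polynomial (Gam n V W)) where
  carrier := {P | ∀ i, P.coeff i ∈ semiInvariants n l V W i}
  add_mem' {P Q} hP hQ i := by
    rw [Polynomial.coeff_add]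
    exact add_mem (hP i) (hQ i)
  mul_mem' {P Q} hP hQ i := by
    rw [Polynomial.coeff_mul]
    refine sum_mem fun x hx => ?_
    rw [← Finset.HasAntidiagonal.mem_antidiagonal.1 hx]
    exact SetLike.GradedMul.mul_mem (hP x.1) (hQ x.2)
  algebraMap_mem' r i := by
    rw [Polynomial.algebraMap_apply, Polynomial.coeff_C]
    split_ifs with h
    · subst h
      rw [Algebra.algebraMap_eq_smul_one]
      exact Submodule.smul_mem _ r SetLike.GradedOne.one_mem
    · exact zero_mem _

/-- The `i`-th graded piece `Γ(𝒱(n, c))^{G, χ^i} · z^i` of the ring of semi-invariants. -/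
def piece (i : ℕ) : Submodule ℂ (SemiInvariantRing n l V W) where
  carrier := {P | ∀ j, j ≠ i → P.1.coeff j = 0}
  add_mem' {P Q} hP hQ j hj := by
    change (P.1 + Q.1).coeff j = 0
    rw [Polynomial.coeff_add, hP j hj, hQ j hj, add_zero]
  zero_mem' j _ := Polynomial.coeff_zero j
  smul_mem' r P hP j hj := by
    change (r • P.1).coeff j = 0
    rw [Polynomial.coeff_smul, hP j hj, smul_zero]

variable {n l V W} in
/-- A semi-invariant `f` of weight `χ^i`, as the homogeneous element `f z^i`. -/
def toPiece {i : ℕ} (f : semiInvariants n l V W i) : piece n l V W i :=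
  ⟨⟨Polynomial.monomial i f.1, fun j => by
    rw [Polynomial.coeff_monomial]
    split_ifs with h
    · exact h ▸ f.2
    · exact zero_mem _⟩, fun j hj => by
    change (Polynomial.monomial i f.1).coeff j = 0
    rw [Polynomial.coeff_monomial, if_neg hj.symm]⟩

theorem toPiece_coeff {i : ℕ} (P : piece n l V W i) :
    toPiece ⟨P.1.1.coeff i, P.1.2 i⟩ = P := by
  refine Subtype.ext (Subtype.ext (Polynomial.ext fun j => ?_))
  change (Polynomial.monomial i (P.1.1.coeff i)).coeff j = P.1.1.coeff j
  rw [Polynomial.coeff_monomial]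
  split_ifs with h
  · subst h; rfl
  · exact (P.2 j (Ne.symm h)).symm

instance : SetLike.GradedMonoid (piece n l V W) where
  one_mem j hj := by
    change (1 : Polynomial (Gam n V W)).coeff j = 0
    rw [Polynomial.coeff_one, if_neg hj]
  mul_mem i j P Q hP hQ k hk := by
    change (P.1 * Q.1).coeff k = 0
    rw [Polynomial.coeff_mul]
    refine Finset.sum_eq_zero fun x hx => ?_
    rw [Finset.HasAntidiagonal.mem_antidiagonal] at hx
    by_cases h : x.1 = i
    · rw [hQ x.2 (by omega), mul_zero]
    · rw [hP x.1 h, zero_mul]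

theorem coeff_coeAddMonoidHom (x : ⨁ i, piece n l V W i) (j : ℕ) :
    (DirectSum.coeAddMonoidHom (piece n l V W) x).1.coeff j = (x j).1.1.coeff j := by
  induction x using DirectSum.induction_on with
  | zero => rw [map_zero]; rfl
  | of i P =>
    rw [DirectSum.coeAddMonoidHom_of]
    by_cases h : j = i
    · subst h
      rw [DirectSum.of_eq_same]
    · rw [DirectSum.of_eq_of_ne _ _ _ h]
      exact P.2 j h
  | add x y hx hy =>
    rw [map_add, DirectSum.add_apply]
    change (_ + _ : Polynomial (Gam n V W)).coeff j = (_ + _ : Polynomial (Gam n V W)).coeff j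
    rw [Polynomial.coeff_add, Polynomial.coeff_add, hx, hy]

/-- The homogeneous components `f_i z^i` of `∑ f_i z^i`. -/
def components (P : SemiInvariantRing n l V W) : ⨁ i, piece n l V W i :=
  DirectSum.mk (fun i => piece n l V W i) P.1.support fun i => toPiece ⟨P.1.coeff i, P.2 i⟩

theorem components_apply (P : SemiInvariantRing n l V W) (i : ℕ) :
    components n l V W P i = toPiece ⟨P.1.coeff i, P.2 i⟩ := by
  by_cases h : i ∈ P.1.support
  · exact DirectSum.mk_apply_of_mem h
  · refine (DirectSum.mk_apply_of_notMem h).trans (Subtype.ext (Subtype.ext ?_))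
    change 0 = Polynomial.monomial i (P.1.coeff i)
    rw [Polynomial.notMem_support_iff.1 h, Polynomial.monomial_zero_right]

instance : GradedRing (piece n l V W) where
  decompose' := components n l V W
  left_inv P := by
    refine Subtype.ext (Polynomial.ext fun j => ?_)
    rw [coeff_coeAddMonoidHom, components_apply]
    change (Polynomial.monomial j (P.1.coeff j)).coeff j = P.1.coeff j
    rw [Polynomial.coeff_monomial_same]
  right_inv x := by
    refine DFinsupp.ext fun i => ?_
    refine (components_apply n l V W _ i).trans ?_
    rw [← toPiece_coeff n l V W (x i)]
    congr 2
    exact coeff_coeAddMonoidHom n l V W x i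

/-- The GIT quotient `ℳ(n, c) = 𝒱(n, c) //_χ GL(V) = Proj (⨁_{i ≥ 0} Γ(𝒱(n, c))^{G, χ^i})`. -/
abbrev GITQuotient : Scheme := Proj (piece n l V W)

/-- The closed points of the GIT quotient, with the topology induced from the scheme. -/
abbrev ClosedPoints : Type _ := {p : GITQuotient n l V W // IsClosed {p}}

/-- The orbit space `𝒱(n, c)^st / GL(V)`, with the quotient topology. -/
abbrev OrbitSpace : Type _ :=
  MulAction.orbitRel.Quotient (LinearMap.GeneralLinearGroup ℂ V) (StableLocus n V W)

end

section

variable {n l : ℕ} {V W : Type*} [AddCommGroup V] [Module ℂ V] [AddCommGroup W] [Module ℂ W]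

/-- The point `p` of the GIT quotient is the image of the datum `X`: its homogeneous prime ideal
consists of the elements of the ring of semi-invariants all of whose homogeneous components vanish
at `X`. -/
def IsImage (X : Variety n V W) (p : GITQuotient n l V W) : Prop :=
  ∀ a : SemiInvariantRing n l V W, a ∈ p.asHomogeneousIdeal ↔ ∀ i, (a.1.coeff i) X = 0

instance (p : GITQuotient n l V W) : p.asHomogeneousIdeal.toIdeal.IsPrime :=
  ProjectiveSpectrum.isPrime p

/-- The section `s` of the structure sheaf over `U ∋ p`, where `p` is the image of `X`, takes the
value `v` at `X`: near `p` it is a fraction `a / b` of semi-invariants of the same weight with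
`b(X) ≠ 0` and `v = a(X) / b(X)`. -/
def HasValue {U : (GITQuotient n l V W).Opens} (s : Γ(GITQuotient n l V W, U))
    (p : GITQuotient n l V W) (hp : p ∈ U) (X : Variety n V W) (v : ℂ) : Prop :=
  ∃ (i : ℕ) (a b : semiInvariants n l V W i)
    (hb : ((toPiece b : piece n l V W i) : SemiInvariantRing n l V W) ∈
      p.asHomogeneousIdeal.toIdeal.primeCompl),
    (Proj.stalkIso (piece n l V W) p).hom ((GITQuotient n l V W).presheaf.germ U p hp s) =
        HomogeneousLocalization.mk ⟨i, toPiece a, toPiece b, hb⟩ ∧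
      b.1 X ≠ 0 ∧ v = a.1 X / b.1 X

/-- A function on a subset `Ω` of the stable locus is regular if, locally in the Zariski topology
of `Ω`, it is a quotient of two regular functions on `𝒱(n, c)`. -/
def IsRegular {Ω : Set (StableLocus n V W)} (f : Ω → ℂ) : Prop :=
  ∀ X : Ω, ∃ p q : Gam n V W, q X.1.1 ≠ 0 ∧
    ∀ Y : Ω, q Y.1.1 ≠ 0 → f Y = p Y.1.1 / q Y.1.1

/-- A function on a subset `Ω` of the stable locus is invariant if it is constant along the
intersections of `Ω` with the `GL(V)`-orbits. -/
def IsInvariant {Ω : Set (StableLocus n V W)} (f : Ω → ℂ) : Prop :=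
  ∀ X Y : Ω, (∃ g : LinearMap.GeneralLinearGroup ℂ V, Y.1 = g • X.1) → f Y = f X

end

end ADHM

end

/-!
# The GIT quotient of the variety of ADHM data is the orbit space of its stable locus

Fix a vector `w₀` spanning `W`. Every word `i₁ ⋯ i_r` in the indices of the operators gives a
vector `B_{i₁} ⋯ B_{i_r} I(w₀)` of `V`, and these vectors span the smallest subspace that contains
`I(W)` and is preserved by the operators. So a datum is stable if and only if some family `m` of
`c` words gives a basis of `V` (`isStable_iff`), that is, if the determinant `D_m` of these
vectors is not zero. The power `d_m = D_m ^ l` is a semi-invariant of weight `χ`. All arguments go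
through the slice of the data at which the vectors of `m` form a given basis: an orbit on which
`D_m ≠ 0` meets the slice in a single point, the coordinates of a datum in the slice are quotients
of determinants by Cramer's rule, and therefore every regular function agrees on the slice with a
semi-invariant `F` of some weight `χ ^ N`, a *numerator* of it (`exists_isNumerator`). In other
words the regular functions on the slice are the fractions `F / d_m ^ N`. This replaces averaging
over the group.

*Closed orbits.* An unstable datum degenerates, under a one-parameter subgroup that fixes a
destabilizing subspace, to a limit at which the last coordinate of `(X, z)` is `0`
(`exists_mem_closure_orbit_coord_eq_zero`). Consequently semi-invariants of positive weight vanish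
at unstable data. For stable `X` the orbit of `(X, z)` is cut out by the equations `z d_m = const`
and `F = const · d_m ^ N`, where `F` runs through the numerators of all regular functions
(`isClosed_orbit_iff`).

*The determinantal semi-invariants have no common zero on the quotient* (`exists_semiDet_notMem`).
Given a homogeneous prime `p`, a valuation ring `O` dominating its local ring is taken in a field
over which there is a datum. Characteristic polynomials of the operators are invariant, so they
have coefficients in `O`. As the operators commute, the `O`-module generated by the vectors of all
words is then finitely generated, and a family `m` for which `D_m` has maximal valuation gives a
basis of this lattice. Then all fractions `F / d_m ^ N` lie in `O`, so that `d_m ∈ p` would force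
all semi-invariants of positive weight into `p`.

*Points and topology.* For `p` with `d_m ∉ p`, the functions with numerators in `p` form a prime
ideal of regular functions, and Hilbert's Nullstellensatz yields stable data at which `p`
vanishes, in any given basic open neighbourhood of `p` (`exists_stable_specialization`).
Semi-invariants separate orbits of stable data (`exists_eq_smul_of_vanishing`). Hence the closed
points are the images of the stable data, one for each orbit. The bijection is a homeomorphism
because an open invariant set of stable data is a union of sets `{b ≠ 0}` with `b` a
semi-invariant, obtained as the numerator of a regular function
(`exists_semiInvariant_of_isOpen`).

*Sections.* In the same way numerators turn a local expression of an invariant regular function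
into a fraction of semi-invariants of the same weight (`exists_frac_of_isInvariant`). These
fractions glue, since fractions that agree at the stable data are equal in the local rings
(`frac_eq_frac_of_forall_stable`).
-/

noncomputable section

open scoped Topology

set_option linter.unusedSectionVars false

namespace ADHM

variable {n l : ℕ} {V W : Type*} [AddCommGroup V] [Module ℂ V] [AddCommGroup W] [Module ℂ W]

/-! ### Regular functions -/

section Regular

variable {Y E : Type*} [AddCommGroup E] [Module ℂ E] {ι : Y → E}

theorem regularFunctions.dual_mem (φ : Module.Dual ℂ E) :
    (fun y => φ (ι y)) ∈ regularFunctions ι :=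
  Algebra.subset_adjoin ⟨φ, rfl⟩

/-- The principal open sets form a basis of the Zariski topology. -/
theorem exists_regular_of_isOpen {U : Set Y} (hU : IsOpen[zariskiTopology ι] U) {x : Y}
    (hx : x ∈ U) : ∃ f ∈ regularFunctions ι, f x ≠ 0 ∧ ∀ y, f y ≠ 0 → y ∈ U := by
  induction hU with
  | basic s hs =>
    obtain ⟨f, hf, rfl⟩ := hs
    exact ⟨f, hf, hx, fun y hy => hy⟩
  | univ => exact ⟨1, one_mem _, one_ne_zero, fun _ _ => trivial⟩
  | inter s t _ _ hs ht =>
    obtain ⟨f, hf, hfx, hfs⟩ := hs hx.1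
    obtain ⟨g, hg, hgx, hgt⟩ := ht hx.2
    exact ⟨f * g, mul_mem hf hg, mul_ne_zero hfx hgx, fun y hy =>
      ⟨hfs y (left_ne_zero_of_mul hy), hgt y (right_ne_zero_of_mul hy)⟩⟩
  | sUnion S _ ih =>
    obtain ⟨s, hs, hxs⟩ := hx
    obtain ⟨f, hf, hfx, hfs⟩ := ih s hs hxs
    exact ⟨f, hf, hfx, fun y hy => ⟨s, hs, hfs y hy⟩⟩

theorem isOpen_ne_zero {f : Y → ℂ} (hf : f ∈ regularFunctions ι) :
    IsOpen[zariskiTopology ι] {y | f y ≠ 0} :=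
  GenerateOpen.basic _ ⟨f, hf, rfl⟩

/-- Pulling back along a map that is the restriction of a linear map preserves regularity. -/
theorem regularFunctions.comp_mem {Y' E' : Type*} [AddCommGroup E'] [Module ℂ E'] {ι' : Y' → E'}
    {φ : Y' → Y} (L : E' →ₗ[ℂ] E) (h : ∀ y, ι (φ y) = L (ι' y)) {f : Y → ℂ}
    (hf : f ∈ regularFunctions ι) : f ∘ φ ∈ regularFunctions ι' := by
  induction hf using Algebra.adjoin_induction with
  | mem f hf =>
    obtain ⟨ψ, rfl⟩ := hf
    refine Algebra.subset_adjoin ⟨ψ ∘ₗ L, funext fun y => ?_⟩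
    simp [h]
  | algebraMap r => exact (regularFunctions ι').algebraMap_mem r
  | add f g _ _ hf hg => exact add_mem hf hg
  | mul f g _ _ hf hg => exact mul_mem hf hg

/-- A regular function restricts to a polynomial on a curve with polynomial coordinates. -/
theorem regularFunctions.exists_polynomial {γ : ℂ → Y}
    (hγ : ∀ φ : Module.Dual ℂ E, ∃ P : Polynomial ℂ, ∀ s, φ (ι (γ s)) = P.eval s) {f : Y → ℂ}
    (hf : f ∈ regularFunctions ι) : ∃ P : Polynomial ℂ, ∀ s, f (γ s) = P.eval s := by
  induction hf using Algebra.adjoin_induction with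
  | mem f hf =>
    obtain ⟨ψ, rfl⟩ := hf
    exact hγ ψ
  | algebraMap r => exact ⟨.C r, fun s => by simp⟩
  | add f g _ _ hf hg =>
    obtain ⟨P, hP⟩ := hf
    obtain ⟨Q, hQ⟩ := hg
    exact ⟨P + Q, fun s => by simp [hP, hQ]⟩
  | mul f g _ _ hf hg =>
    obtain ⟨P, hP⟩ := hf
    obtain ⟨Q, hQ⟩ := hg
    exact ⟨P * Q, fun s => by simp [hP, hQ]⟩

/-- If a curve with polynomial coordinates lies in a set except for its value at `0`, then its value
at `0` lies in the Zariski closure of the set. -/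
theorem mem_closure_of_curve {γ : ℂ → Y}
    (hγ : ∀ φ : Module.Dual ℂ E, ∃ P : Polynomial ℂ, ∀ s, φ (ι (γ s)) = P.eval s) {Z : Set Y}
    (hZ : ∀ s ≠ 0, γ s ∈ Z) : γ 0 ∈ @closure _ (zariskiTopology ι) Z := by
  let _ := zariskiTopology ι
  rw [mem_closure_iff]
  intro U hU h0
  obtain ⟨f, hf, hf0, hfU⟩ := exists_regular_of_isOpen hU h0
  obtain ⟨P, hP⟩ := regularFunctions.exists_polynomial hγ hf
  have hP0 : P * Polynomial.X ≠ 0 :=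
    mul_ne_zero (fun h => hf0 (by rw [hP, h, Polynomial.eval_zero])) Polynomial.X_ne_zero
  obtain ⟨s, hs⟩ : ∃ s, (P * Polynomial.X).eval s ≠ 0 := by
    by_contra! h
    exact hP0 (Polynomial.funext fun s => by rw [h, Polynomial.eval_zero])
  rw [Polynomial.eval_mul, Polynomial.eval_X] at hs
  exact ⟨γ s, hfU _ (by rw [hP]; exact left_ne_zero_of_mul hs), hZ s (right_ne_zero_of_mul hs)⟩

end Regular

theorem Gam.ext {f g : Gam n V W} (h : ∀ X, f X = g X) : f = g :=
  Subtype.ext (funext h)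

/-- Evaluation of regular functions at a point. -/
def Gam.eval (X : Variety n V W) : Gam n V W →ₐ[ℂ] ℂ where
  toFun f := f X
  map_one' := rfl
  map_mul' _ _ := rfl
  map_zero' := rfl
  map_add' _ _ := rfl
  commutes' _ := rfl

theorem Gam.eval_apply (X : Variety n V W) (f : Gam n V W) : Gam.eval X f = f X := rfl

@[simp] theorem Gam.add_apply (f g : Gam n V W) (X : Variety n V W) : (f + g) X = f X + g X := rfl
@[simp] theorem Gam.mul_apply (f g : Gam n V W) (X : Variety n V W) : (f * g) X = f X * g X := rfl
@[simp] theorem Gam.sub_apply (f g : Gam n V W) (X : Variety n V W) : (f - g) X = f X - g X := rfl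
@[simp] theorem Gam.zero_apply (X : Variety n V W) : (0 : Gam n V W) X = 0 := rfl
@[simp] theorem Gam.one_apply (X : Variety n V W) : (1 : Gam n V W) X = 1 := rfl
@[simp] theorem Gam.pow_apply (f : Gam n V W) (k : ℕ) (X : Variety n V W) : (f ^ k) X = f X ^ k :=
  rfl

/-- The restriction of a linear form to the variety of ADHM data. -/
def Gam.ofDual (φ : Module.Dual ℂ (Datum n V W)) : Gam n V W :=
  ⟨fun X => φ X.toDatum, regularFunctions.dual_mem φ⟩

@[simp] theorem Gam.ofDual_apply (φ : Module.Dual ℂ (Datum n V W)) (X : Variety n V W) :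
    Gam.ofDual φ X = φ X.toDatum := rfl

theorem Gam.induction {p : Gam n V W → Prop} (dual : ∀ φ, p (Gam.ofDual φ))
    (scalar : ∀ r : ℂ, p (algebraMap ℂ _ r)) (add : ∀ f g, p f → p g → p (f + g))
    (mul : ∀ f g, p f → p g → p (f * g)) (f : Gam n V W) : p f := by
  obtain ⟨f, hf⟩ := f
  induction hf using Algebra.adjoin_induction with
  | mem f hf =>
    obtain ⟨ψ, rfl⟩ := hf
    exact dual ψ
  | algebraMap r => exact scalar r
  | add f g hf hg h1 h2 => exact add ⟨f, hf⟩ ⟨g, hg⟩ h1 h2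
  | mul f g hf hg h1 h2 => exact mul ⟨f, hf⟩ ⟨g, hg⟩ h1 h2

/-! ### Coordinates and generic matrices -/

section Coordinates

variable {ι : Type*} (e : Module.Basis ι ℂ V) (w₀ : W)

/-- The matrix entry of `B_i` in position `(j, k)`, as a linear form. -/
def entryB (i : Fin n) (j k : ι) : Module.Dual ℂ (Datum n V W) where
  toFun X := e.coord j (X.B i (e k))
  map_add' X Y := map_add (e.coord j) (X.B i (e k)) (Y.B i (e k))
  map_smul' r X := map_smul (e.coord j) r (X.B i (e k))

/-- The `j`-th coordinate of `I(w₀)`, as a linear form. -/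
def entryI (n : ℕ) (j : ι) : Module.Dual ℂ (Datum n V W) where
  toFun X := e.coord j (X.I w₀)
  map_add' X Y := map_add (e.coord j) (X.I w₀) (Y.I w₀)
  map_smul' r X := map_smul (e.coord j) r (X.I w₀)

/-- The matrix of `B_i`, with entries in the ring of regular functions. -/
def genB (W : Type*) [AddCommGroup W] [Module ℂ W] (i : Fin n) : Matrix ι ι (Gam n V W) :=
  Matrix.of fun j k => Gam.ofDual (entryB e i j k)

/-- The coordinate vector of `I(w₀)`, with entries in the ring of regular functions. -/
def genI (n : ℕ) : ι → Gam n V W := fun j => Gam.ofDual (entryI e w₀ n j)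

theorem genB_apply (i : Fin n) (j k : ι) (X : Variety n V W) :
    genB e W i j k X = e.repr (X.toDatum.B i (e k)) j := rfl

theorem genI_apply (j : ι) (X : Variety n V W) :
    genI e w₀ n j X = e.repr (X.toDatum.I w₀) j := rfl

variable [Fintype ι]

variable {w₀} in
/-- Every linear form on the space of data is a combination of matrix entries. -/
theorem exists_dual_eq_sum (hw : ∀ w : W, ∃ c : ℂ, c • w₀ = w) (φ : Module.Dual ℂ (Datum n V W)) :
    ∃ (a : Fin n × ι × ι → ℂ) (b : ι → ℂ),
      φ = ∑ t, a t • entryB e t.1 t.2.1 t.2.2 + ∑ j, b j • entryI e w₀ n j := by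
  classical
  let Φ : Datum n V W →ₗ[ℂ] ((Fin n × ι × ι) ⊕ ι → ℂ) :=
    LinearMap.pi (Sum.elim (fun t => entryB e t.1 t.2.1 t.2.2) (fun j => entryI e w₀ n j))
  have hΦ : LinearMap.ker Φ = ⊥ := by
    rw [LinearMap.ker_eq_bot']
    intro X hX
    refine Prod.ext (funext fun i => e.ext fun k => e.ext_elem fun j => ?_)
      (LinearMap.ext fun w => e.ext_elem fun j => ?_)
    · have := congrFun hX (Sum.inl (i, j, k))
      have h2 : e.repr (X.1 i (e k)) j = 0 := this
      have h3 : e.repr ((0 : Module.End ℂ V) (e k)) j = 0 := by simp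
      exact h2.trans h3.symm
    · have := congrFun hX (Sum.inr j)
      obtain ⟨c, rfl⟩ := hw w
      have h2 : e.repr (X.2 w₀) j = 0 := this
      have h3 : e.repr ((0 : W →ₗ[ℂ] V) (c • w₀)) j = 0 := by simp
      refine Eq.trans ?_ h3.symm
      rw [map_smul, map_smul, Finsupp.smul_apply, h2, smul_zero]
  obtain ⟨L, hL⟩ := LinearMap.exists_leftInverse_of_injective Φ hΦ
  refine ⟨fun t => φ (L (Pi.single (Sum.inl t) 1)), fun j => φ (L (Pi.single (Sum.inr j) 1)),
    LinearMap.ext fun X => ?_⟩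
  have h1 : φ X = (φ ∘ₗ L) (Φ X) := by
    change φ X = φ ((L ∘ₗ Φ) X)
    rw [hL]; rfl
  rw [h1, LinearMap.pi_apply_eq_sum_univ (φ ∘ₗ L) (Φ X), Fintype.sum_sum_type]
  simp only [LinearMap.add_apply, LinearMap.sum_apply, LinearMap.smul_apply, smul_eq_mul]
  have hs : ∀ t, (fun j => if t = j then (1 : ℂ) else 0) =
      (Pi.single t 1 : (Fin n × ι × ι) ⊕ ι → ℂ) := fun t => funext fun j => by
    rw [Pi.single_apply]
    exact if_congr eq_comm rfl rfl
  simp only [hs]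
  congr 1 <;> refine Finset.sum_congr rfl fun t _ => ?_ <;> rw [mul_comm] <;> rfl

variable {w₀} in
/-- The regular functions are generated by the matrix entries. -/
theorem Gam.induction_entries (hw : ∀ w : W, ∃ c : ℂ, c • w₀ = w) {p : Gam n V W → Prop}
    (entryB : ∀ i j k, p (genB e W i j k)) (entryI : ∀ j, p (genI e w₀ n j))
    (scalar : ∀ r : ℂ, p (algebraMap ℂ _ r)) (add : ∀ f g, p f → p g → p (f + g))
    (mul : ∀ f g, p f → p g → p (f * g)) (f : Gam n V W) : p f := by
  have hzero : p 0 := by simpa using scalar 0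
  have hsum : ∀ {τ : Type _} (s : Finset τ) (u : τ → Gam n V W), (∀ t, p (u t)) →
      p (∑ t ∈ s, u t) := fun s u hu => by
    classical
    induction s using Finset.induction_on with
    | empty => simpa
    | insert a s has ih => rw [Finset.sum_insert has]; exact add _ _ (hu a) ih
  have hsmul : ∀ (r : ℂ) f, p f → p (r • f) := fun r f hf => by
    rw [Algebra.smul_def]; exact mul _ _ (scalar r) hf
  induction f using Gam.induction with
  | dual φ =>
    obtain ⟨a, b, rfl⟩ := exists_dual_eq_sum e hw φ
    have : Gam.ofDual (∑ t, a t • ADHM.entryB e t.1 t.2.1 t.2.2 +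
          ∑ j, b j • ADHM.entryI e w₀ n j) =
        ∑ t, a t • genB e W t.1 t.2.1 t.2.2 + ∑ j, b j • genI e w₀ n j := by
      refine Gam.ext fun X => ?_
      rw [← Gam.eval_apply, ← Gam.eval_apply, map_add, map_sum, map_sum, Gam.eval_apply,
        Gam.ofDual_apply, LinearMap.add_apply, LinearMap.sum_apply, LinearMap.sum_apply]
      rfl
    rw [this]
    exact add _ _ (hsum _ _ fun t => hsmul _ _ (entryB _ _ _))
      (hsum _ _ fun t => hsmul _ _ (entryI _))
  | scalar r => exact scalar r
  | add f g hf hg => exact add f g hf hg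
  | mul f g hf hg => exact mul f g hf hg

variable {w₀} in
/-- The datum is determined by the values of the regular functions. -/
theorem Variety.ext_eval {X Y : Variety n V W} (hw : ∀ w : W, ∃ c : ℂ, c • w₀ = w)
    (h : ∀ f : Gam n V W, f X = f Y) : X = Y := by
  let e := Module.Basis.ofVectorSpace ℂ V
  refine Subtype.ext (Prod.ext (funext fun i => e.ext fun k => e.ext_elem fun j => ?_)
      (LinearMap.ext fun w => e.ext_elem fun j => ?_))
  · exact h (genB e W i j k)
  · obtain ⟨c, rfl⟩ := hw w
    have h2 : e.repr (X.1.2 w₀) j = e.repr (Y.1.2 w₀) j := h (genI e w₀ n j)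
    simp [h2]

variable [DecidableEq ι]

theorem genB_comm (i j : Fin n) : genB e W i * genB e W j = genB e W j * genB (V := V) e W i := by
  refine Matrix.ext fun a b => Gam.ext fun X => ?_
  have key : ∀ i j : Fin n, (genB e W i * genB e W j) a b X =
      e.repr ((X.toDatum.B i * X.toDatum.B j) (e b)) a := fun i j => by
    rw [← LinearMap.toMatrix_apply, LinearMap.toMatrix_mul]
    rw [Matrix.mul_apply, Matrix.mul_apply, ← Gam.eval_apply, map_sum]
    refine Finset.sum_congr rfl fun t _ => ?_
    rw [LinearMap.toMatrix_apply, LinearMap.toMatrix_apply]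
    rfl
  rw [key, key]
  exact congrArg (fun T : Module.End ℂ V => e.repr (T (e b)) a) (X.2 i j)

/-! ### Points -/

variable {w₀} in
/-- Every `ℂ`-algebra homomorphism from the regular functions to `ℂ` is the evaluation at a point.
-/
theorem exists_eval_eq [FiniteDimensional ℂ V] (hw : ∀ w : W, ∃ c : ℂ, c • w₀ = w) (hw₀ : w₀ ≠ 0)
    (θ : Gam n V W →ₐ[ℂ] ℂ) : ∃ X : Variety n V W, ∀ f, θ f = f X := by
  let e := Module.finBasis ℂ V
  obtain ⟨ω, hω⟩ : ∃ ω : Module.Dual ℂ W, ω w₀ = 1 :=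
    Module.Projective.exists_dual_eq_one ℂ hw₀
  let Bm : Fin n → Module.End ℂ V := fun i => Matrix.toLin e e ((genB e W i).map θ)
  let u : V := ∑ j, θ (genI e w₀ n j) • e j
  let X : Variety n V W := ⟨(Bm, ω.smulRight u), fun i j => by
    change Bm i * Bm j = Bm j * Bm i
    simp only [Bm, Module.End.mul_eq_comp]
    rw [← Matrix.toLin_mul, ← Matrix.toLin_mul, ← Matrix.map_mul, ← Matrix.map_mul, genB_comm]⟩
  refine ⟨X, fun f => ?_⟩
  induction f using Gam.induction_entries e hw with
  | entryB i j k =>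
    rw [genB_apply]
    change _ = e.repr (Matrix.toLin e e ((genB e W i).map θ) (e k)) j
    rw [Matrix.toLin_self, e.repr_sum_self]
    rfl
  | entryI j =>
    rw [genI_apply]
    change _ = e.repr (ω w₀ • u) j
    rw [hω, one_smul, e.repr_sum_self]
  | scalar r => rw [AlgHom.commutes]; rfl
  | add f g hf hg => rw [map_add, hf, hg]; rfl
  | mul f g hf hg => rw [map_mul, hf, hg]; rfl

variable {w₀} in
theorem Gam.finiteType [FiniteDimensional ℂ V] (hw : ∀ w : W, ∃ c : ℂ, c • w₀ = w) :
    Algebra.FiniteType ℂ (Gam n V W) := by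
  classical
  let e := Module.finBasis ℂ V
  let S : Finset (Gam n V W) :=
    Finset.univ.image (fun t : Fin n × Fin _ × Fin _ => genB e W t.1 t.2.1 t.2.2) ∪
      Finset.univ.image (genI e w₀ n)
  refine ⟨⟨S, eq_top_iff.2 fun f _ => ?_⟩⟩
  induction f using Gam.induction_entries e hw with
  | entryB i j k =>
    exact Algebra.subset_adjoin (Finset.mem_union_left _
      (Finset.mem_image.2 ⟨(i, j, k), Finset.mem_univ _, rfl⟩))
  | entryI j =>
    exact Algebra.subset_adjoin (Finset.mem_union_right _
      (Finset.mem_image.2 ⟨j, Finset.mem_univ _, rfl⟩))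
  | scalar r => exact Subalgebra.algebraMap_mem _ r
  | add f g hf hg => exact add_mem (hf trivial) (hg trivial)
  | mul f g hf hg => exact mul_mem (hf trivial) (hg trivial)

variable {w₀} in
/-- The Nullstellensatz for the variety of ADHM data: a regular function outside a prime ideal is
nonzero at some common zero of the ideal. -/
theorem exists_zero_of_notMem_prime [FiniteDimensional ℂ V] (hw : ∀ w : W, ∃ c : ℂ, c • w₀ = w)
    (hw₀ : w₀ ≠ 0) (P : Ideal (Gam n V W)) [P.IsPrime] {f : Gam n V W} (hf : f ∉ P) :
    ∃ X : Variety n V W, (∀ g ∈ P, g X = 0) ∧ f X ≠ 0 := by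
  have hft : Algebra.FiniteType ℂ (Gam n V W) := Gam.finiteType hw
  have : IsJacobsonRing (Gam n V W) := isJacobsonRing_of_finiteType (A := ℂ)
  rw [← isJacobsonRing_iff_prime_eq.1 this P inferInstance, Ideal.jacobson, Ideal.mem_sInf] at hf
  push Not at hf
  obtain ⟨M, ⟨hPM, hM⟩, hfM⟩ := hf
  let _ := Ideal.Quotient.field M
  have : Module.Finite ℂ (Gam n V W ⧸ M) := finite_of_finite_type_of_isJacobsonRing _ _
  let ψ : ℂ ≃ₐ[ℂ] (Gam n V W ⧸ M) := AlgEquiv.ofBijective (Algebra.ofId _ _)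
    (IsAlgClosed.algebraMap_bijective_of_isIntegral (k := ℂ))
  obtain ⟨X, hX⟩ := exists_eval_eq hw hw₀
    ((ψ.symm : (Gam n V W ⧸ M) →ₐ[ℂ] ℂ).comp (Ideal.Quotient.mkₐ ℂ M))
  have key : ∀ g, g X = 0 ↔ g ∈ M := fun g => by
    rw [← hX, ← Ideal.Quotient.eq_zero_iff_mem]
    exact map_eq_zero_iff ψ.symm ψ.symm.injective
  exact ⟨X, fun g hg => (key g).2 (hPM hg), fun h => hfM ((key f).1 h)⟩

end Coordinates

/-! ### Words in the operators and the determinantal semi-invariants -/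

/-- The vector `B_{i₁} ⋯ B_{i_r} I(w₀)` attached to the word `i₁ ⋯ i_r`. -/
def word (w₀ : W) (X : Datum n V W) : List (Fin n) → V
  | [] => X.I w₀
  | i :: w => X.B i (word w₀ X w)

theorem word_smul (w₀ : W) (g : LinearMap.GeneralLinearGroup ℂ V) (X : Datum n V W)
    (w : List (Fin n)) : word w₀ (g • X) w = (g : Module.End ℂ V) (word w₀ X w) := by
  induction w with
  | nil => rfl
  | cons i w ih =>
    rw [word, word, ih, Datum.smul_B, Module.End.mul_apply, Module.End.mul_apply,
      ← Module.End.mul_apply _ _ (word w₀ X w), Units.inv_mul, Module.End.one_apply]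

theorem Variety.toDatum_smul (g : LinearMap.GeneralLinearGroup ℂ V) (X : Variety n V W) :
    (g • X).toDatum = g • X.toDatum := rfl

theorem character_apply (g : LinearMap.GeneralLinearGroup ℂ V) :
    (character l V g : ℂ) = LinearMap.det (g : Module.End ℂ V) ^ l := by
  simp [character]

section Frame

variable {ι : Type*} [Fintype ι] [DecidableEq ι] (e : Module.Basis ι ℂ V) (w₀ : W)

/-- The coordinates of the vector attached to a word, as regular functions. -/
def genWord : List (Fin n) → ι → Gam n V W
  | [] => genI e w₀ n
  | i :: w => (genB e W i).mulVec (genWord w)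

theorem genWord_apply (w : List (Fin n)) (j : ι) (X : Variety n V W) :
    genWord e w₀ w j X = e.repr (word w₀ X.toDatum w) j := by
  induction w generalizing j with
  | nil => rfl
  | cons i w ih =>
    rw [genWord, Matrix.mulVec, dotProduct, ← Gam.eval_apply, map_sum]
    conv_rhs => rw [word, ← e.sum_repr (word w₀ X.toDatum w), map_sum, map_sum,
      Finsupp.finsetSum_apply]
    refine Finset.sum_congr rfl fun k _ => ?_
    rw [map_mul, Gam.eval_apply, Gam.eval_apply, ih, map_smul, map_smul, Finsupp.smul_apply,
      smul_eq_mul, mul_comm, genB_apply]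

/-- The determinant of the vectors attached to a family of words. -/
def frameDet (m : ι → List (Fin n)) : Gam n V W :=
  (Matrix.of fun j k => genWord e w₀ (m k) j).det

theorem frameDet_apply (m : ι → List (Fin n)) (X : Variety n V W) :
    frameDet e w₀ m X = e.det fun k => word w₀ X.toDatum (m k) := by
  rw [frameDet, ← Gam.eval_apply, AlgHom.map_det, Module.Basis.det_apply]
  congr 1
  exact Matrix.ext fun j k => genWord_apply e w₀ (m k) j X

theorem frameDet_smul (m : ι → List (Fin n)) (g : LinearMap.GeneralLinearGroup ℂ V)
    (X : Variety n V W) :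
    frameDet e w₀ m (g • X) = LinearMap.det (g : Module.End ℂ V) * frameDet e w₀ m X := by
  rw [frameDet_apply, frameDet_apply, ← Module.Basis.det_comp]
  congr 1
  exact funext fun k => word_smul w₀ g X.toDatum (m k)

/-- The `l`-th power of the determinant of a family of words, a semi-invariant of weight `χ`. -/
def semiDet (l : ℕ) (m : ι → List (Fin n)) : semiInvariants n l V W 1 :=
  ⟨frameDet e w₀ m ^ l, fun g X => by
    rw [Gam.pow_apply, Gam.pow_apply, frameDet_smul, mul_pow, character_apply, pow_one]⟩

theorem semiDet_apply (m : ι → List (Fin n)) (X : Variety n V W) :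
    (semiDet e w₀ l m).1 X = frameDet e w₀ m X ^ l := rfl

/-- The slice of the data for which the vectors attached to the given words are the basis `e`. -/
def slice (m : ι → List (Fin n)) : Set (Variety n V W) :=
  {X | ∀ k, word w₀ X.toDatum (m k) = e k}

variable {e w₀}

theorem frameDet_of_mem_slice {m : ι → List (Fin n)} {X : Variety n V W} (hX : X ∈ slice e w₀ m) :
    frameDet e w₀ m X = 1 := by
  rw [frameDet_apply, funext hX]
  exact e.det_self

/-- The slice meets every orbit on which the determinant does not vanish. -/
theorem exists_smul_mem_slice {m : ι → List (Fin n)} {X : Variety n V W}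
    (hX : frameDet e w₀ m X ≠ 0) :
    ∃ g : LinearMap.GeneralLinearGroup ℂ V, g • X ∈ slice e w₀ m := by
  rw [frameDet_apply] at hX
  obtain ⟨hli, hsp⟩ := (e.is_basis_iff_det).2 (Ne.isUnit hX)
  let b := Module.Basis.mk hli hsp.ge
  refine ⟨LinearMap.GeneralLinearGroup.ofLinearEquiv (b.equiv e (Equiv.refl ι)), fun k => ?_⟩
  rw [Variety.toDatum_smul, word_smul]
  change b.equiv e (Equiv.refl ι) (word w₀ X.toDatum (m k)) = e k
  have : word w₀ X.toDatum (m k) = b k := (Module.Basis.mk_apply hli hsp.ge k).symm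
  rw [this, Module.Basis.equiv_apply, Equiv.refl_apply]

/-- On the slice, replacing one of the words picks out a coordinate of the vector attached to the
new word. -/
theorem frameDet_update_of_mem_slice {m : ι → List (Fin n)} {X : Variety n V W}
    (hX : X ∈ slice e w₀ m) (j : ι) (w : List (Fin n)) :
    frameDet e w₀ (Function.update m j w) X = e.repr (word w₀ X.toDatum w) j := by
  have : (fun k => word w₀ X.toDatum (Function.update m j w k)) =
      Function.update e j (word w₀ X.toDatum w) := funext fun k => by
    rcases eq_or_ne k j with rfl | h
    · simp
    · simp [h, hX k]
  rw [frameDet_apply, this, Module.Basis.det_apply, e.toMatrix_update, e.toMatrix_self,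
    ← Matrix.cramer_apply, Matrix.cramer_one]
  rfl

/-! ### Extending functions from a slice to semi-invariants -/

/-- The function `F` is a semi-invariant of weight `χ^N` with the same restriction as `f` to the
slice. Equivalently, `F / d^N` is the invariant function on the locus `d ≠ 0` that extends the
restriction of `f` to the slice, where `d = semiDet e w₀ l m`. -/
def IsNumerator (e : Module.Basis ι ℂ V) (w₀ : W) (l : ℕ) (m : ι → List (Fin n)) (f : Gam n V W)
    (N : ℕ) (F : Gam n V W) : Prop :=
  F ∈ semiInvariants n l V W N ∧ ∀ X ∈ slice e w₀ m, F X = f X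

theorem semiDet_of_mem_slice {m : ι → List (Fin n)} {X : Variety n V W} (hX : X ∈ slice e w₀ m) :
    (semiDet e w₀ l m).1 X = 1 := by
  rw [semiDet_apply, frameDet_of_mem_slice hX, one_pow]

theorem pow_mem_semiInvariants {i : ℕ} (f : semiInvariants n l V W i) (k : ℕ) :
    f.1 ^ k ∈ semiInvariants n l V W (k * i) := by
  simpa using SetLike.pow_mem_graded k f.2

theorem semiDet_pow_mem (m : ι → List (Fin n)) (k : ℕ) :
    (semiDet e w₀ l m).1 ^ k ∈ semiInvariants n l V W k := by
  simpa using pow_mem_semiInvariants (semiDet e w₀ l m) k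

theorem IsNumerator.of_semiInvariant {m : ι → List (Fin n)} {N : ℕ} {F : Gam n V W}
    (hF : F ∈ semiInvariants n l V W N) : IsNumerator e w₀ l m F N F :=
  ⟨hF, fun _ _ => rfl⟩

theorem IsNumerator.mul {m : ι → List (Fin n)} {f f' F F' : Gam n V W} {N N' : ℕ}
    (h : IsNumerator e w₀ l m f N F) (h' : IsNumerator e w₀ l m f' N' F') :
    IsNumerator e w₀ l m (f * f') (N + N') (F * F') :=
  ⟨SetLike.mul_mem_graded h.1 h'.1, fun X hX => by
    rw [Gam.mul_apply, Gam.mul_apply, h.2 X hX, h'.2 X hX]⟩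

theorem IsNumerator.raise {m : ι → List (Fin n)} {f F : Gam n V W} {N : ℕ}
    (h : IsNumerator e w₀ l m f N F) (k : ℕ) :
    IsNumerator e w₀ l m f (N + k) (F * (semiDet e w₀ l m).1 ^ k) :=
  ⟨SetLike.mul_mem_graded h.1 (semiDet_pow_mem m k), fun X hX => by
    rw [Gam.mul_apply, Gam.pow_apply, h.2 X hX, semiDet_of_mem_slice hX, one_pow, mul_one]⟩

theorem IsNumerator.add {m : ι → List (Fin n)} {f f' F F' : Gam n V W} {N N' : ℕ}
    (h : IsNumerator e w₀ l m f N F) (h' : IsNumerator e w₀ l m f' N' F') :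
    IsNumerator e w₀ l m (f + f') (N + N')
      (F * (semiDet e w₀ l m).1 ^ N' + F' * (semiDet e w₀ l m).1 ^ N) :=
  ⟨add_mem (h.raise N').1 (add_comm N' N ▸ (h'.raise N).1), fun X hX => by
    rw [Gam.add_apply, (h.raise N').2 X hX, (h'.raise N).2 X hX, Gam.add_apply]⟩

/-- The factor `frameDet e w₀ m ^ (l - 1)` raises the weight from `det` to `χ`. -/
theorem IsNumerator.frameDet_update (hl : 0 < l) (m : ι → List (Fin n)) (j : ι) (w : List (Fin n)) :
    IsNumerator e w₀ l m (genWord e w₀ w j) 1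
      (frameDet e w₀ m ^ (l - 1) * frameDet e w₀ (Function.update m j w)) :=
  ⟨fun g X => by
    rw [Gam.mul_apply, Gam.mul_apply, Gam.pow_apply, Gam.pow_apply, frameDet_smul, frameDet_smul,
      character_apply, pow_one, mul_pow, mul_mul_mul_comm, ← pow_succ, Nat.sub_add_cancel hl],
    fun X hX => by
      rw [Gam.mul_apply, Gam.pow_apply, frameDet_of_mem_slice hX, one_pow, one_mul,
        frameDet_update_of_mem_slice hX, genWord_apply]⟩

theorem IsNumerator.congr {m : ι → List (Fin n)} {f f' F : Gam n V W} {N : ℕ}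
    (h : IsNumerator e w₀ l m f N F) (hf : ∀ X ∈ slice e w₀ m, f X = f' X) :
    IsNumerator e w₀ l m f' N F :=
  ⟨h.1, fun X hX => (h.2 X hX).trans (hf X hX)⟩

/-- Induction on regular functions through their restrictions to the slice, where the coordinates
are restrictions of quotients of determinants. -/
theorem exists_isNumerator_and (hl : 0 < l) (hw : ∀ w : W, ∃ c : ℂ, c • w₀ = w)
    (m : ι → List (Fin n)) (p : ℕ → Gam n V W → Prop)
    (det : ∀ j w, p 1 (frameDet e w₀ m ^ (l - 1) * frameDet e w₀ (Function.update m j w)))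
    (scalar : ∀ r : ℂ, p 0 (algebraMap ℂ _ r))
    (add : ∀ N N' F F', p N F → p N' F' →
      p (N + N') (F * (semiDet e w₀ l m).1 ^ N' + F' * (semiDet e w₀ l m).1 ^ N))
    (mul : ∀ N N' F F', p N F → p N' F' → p (N + N') (F * F')) (f : Gam n V W) :
    ∃ N F, IsNumerator e w₀ l m f N F ∧ p N F := by
  induction f using Gam.induction_entries e hw with
  | entryB i j k =>
    refine ⟨_, _, (IsNumerator.frameDet_update hl m j (i :: m k)).congr fun X hX => ?_, det _ _⟩
    rw [genWord_apply, word, hX k, genB_apply]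
  | entryI j => exact ⟨_, _, IsNumerator.frameDet_update hl m j [], det _ _⟩
  | scalar r =>
    exact ⟨0, _, IsNumerator.of_semiInvariant fun g X => by
      rw [pow_zero, one_mul]; rfl, scalar r⟩
  | add f g hf hg =>
    obtain ⟨N, F, hF, pF⟩ := hf
    obtain ⟨N', F', hF', pF'⟩ := hg
    exact ⟨_, _, hF.add hF', add _ _ _ _ pF pF'⟩
  | mul f g hf hg =>
    obtain ⟨N, F, hF, pF⟩ := hf
    obtain ⟨N', F', hF', pF'⟩ := hg
    exact ⟨_, _, hF.mul hF', mul _ _ _ _ pF pF'⟩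

theorem exists_isNumerator (hl : 0 < l) (hw : ∀ w : W, ∃ c : ℂ, c • w₀ = w)
    (m : ι → List (Fin n)) (f : Gam n V W) : ∃ N F, IsNumerator e w₀ l m f N F := by
  obtain ⟨N, F, h, -⟩ := exists_isNumerator_and hl hw m (fun _ _ => True) (fun _ _ => trivial)
    (fun _ => trivial) (fun _ _ _ _ _ _ => trivial) (fun _ _ _ _ _ _ => trivial) f
  exact ⟨N, F, h⟩

theorem apply_eq_zero_of_smul {N : ℕ} {F : Gam n V W} (hF : F ∈ semiInvariants n l V W N)
    {g : LinearMap.GeneralLinearGroup ℂ V} {X : Variety n V W} (h : F (g • X) = 0) : F X = 0 := by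
  rw [hF g X] at h
  exact (mul_eq_zero.1 h).resolve_left (pow_ne_zero _ (Units.ne_zero _))

/-- A semi-invariant that vanishes on the slice vanishes wherever `d` does not. -/
theorem semiDet_mul_eq_zero (hl : 0 < l) {m : ι → List (Fin n)} {N : ℕ} {F : Gam n V W}
    (hF : F ∈ semiInvariants n l V W N) (h : ∀ X ∈ slice e w₀ m, F X = 0) :
    (semiDet e w₀ l m).1 * F = 0 := by
  refine Gam.ext fun X => ?_
  rw [Gam.mul_apply, semiDet_apply, Gam.zero_apply]
  by_cases hX : frameDet e w₀ m X = 0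
  · rw [hX, zero_pow hl.ne', zero_mul]
  · obtain ⟨g, hg⟩ := exists_smul_mem_slice hX
    rw [apply_eq_zero_of_smul hF (h _ hg), mul_zero]

/-- Two numerators of the same function define the same fraction. -/
theorem IsNumerator.semiDet_mul_eq (hl : 0 < l) {m : ι → List (Fin n)} {f F F' : Gam n V W}
    {N N' : ℕ} (h : IsNumerator e w₀ l m f N F) (h' : IsNumerator e w₀ l m f N' F') :
    (semiDet e w₀ l m).1 * (F * (semiDet e w₀ l m).1 ^ N') =
      (semiDet e w₀ l m).1 * (F' * (semiDet e w₀ l m).1 ^ N) := by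
  rw [← sub_eq_zero, ← mul_sub]
  refine semiDet_mul_eq_zero hl (N := N + N')
    (sub_mem (h.raise N').1 (add_comm N' N ▸ (h'.raise N).1)) fun X hX => ?_
  rw [Gam.sub_apply, (h.raise N').2 X hX, (h'.raise N).2 X hX, sub_self]

/-! ### Stability -/

theorem mem_of_invariant {X : Datum n V W} {S : Submodule ℂ V} (hB : ∀ i, S.map (X.B i) ≤ S)
    (hI : LinearMap.range X.I ≤ S) (w : List (Fin n)) : word w₀ X w ∈ S := by
  induction w with
  | nil => exact hI ⟨w₀, rfl⟩
  | cons i w ih => exact hB i ⟨_, ih, rfl⟩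

/-- A datum is stable if and only if some family of words yields a basis of `V`. -/
theorem isStable_iff (hw : ∀ w : W, ∃ c : ℂ, c • w₀ = w) (X : Variety n V W) :
    X.toDatum.IsStable ↔ ∃ m, frameDet e w₀ m X ≠ 0 := by
  constructor
  · intro hX
    have hS : Submodule.span ℂ (Set.range (word w₀ X.toDatum)) = ⊤ := by
      by_contra h
      refine hX ⟨_, h, fun i => ?_, ?_⟩
      · rw [Submodule.map_span, Submodule.span_le]
        rintro _ ⟨_, ⟨w, rfl⟩, rfl⟩
        exact Submodule.subset_span ⟨i :: w, rfl⟩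
      · rintro _ ⟨w, rfl⟩
        obtain ⟨c, rfl⟩ := hw w
        rw [map_smul]
        exact Submodule.smul_mem _ _ (Submodule.subset_span ⟨[], rfl⟩)
    obtain ⟨κ, a, -, hspan, hli⟩ := exists_linearIndependent' ℂ (word w₀ X.toDatum)
    let b := Module.Basis.mk hli (by rw [hspan, hS])
    let σ := e.indexEquiv b
    refine ⟨fun k => a (σ k), ?_⟩
    rw [frameDet_apply]
    have : (fun k => word w₀ X.toDatum (a (σ k))) = b.reindex σ.symm := funext fun k => by
      simp [b]
    rw [this]
    exact (e.isUnit_det _).ne_zero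
  · rintro ⟨m, hm⟩ ⟨S, hS, hB, hI⟩
    rw [frameDet_apply] at hm
    obtain ⟨-, hsp⟩ := (e.is_basis_iff_det).2 (Ne.isUnit hm)
    refine hS (eq_top_iff.2 ?_)
    rw [← hsp, Submodule.span_le]
    rintro _ ⟨k, rfl⟩
    exact mem_of_invariant hB hI _

end Frame

/-! ### Degenerations of unstable data -/

section Idempotent

variable {R : Type*} [Ring R] [Algebra ℂ R] {p b c : R}

/-- For an idempotent `p` whose range is preserved by `b`, the commutator `b p - p b` is, up to
sign, the block of `b` from the kernel of `p` to its range. Two such blocks compose to `0`. -/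
theorem commutator_mul_commutator (hp : p * p = p) (hb : b * p = p * b * p)
    (hc : c * p = p * c * p) : (b * p - p * b) * (c * p - p * c) = 0 := by
  have h1 : b * p * (c * p) = b * (c * p) := by
    rw [hc, ← mul_assoc, ← mul_assoc, ← mul_assoc, mul_assoc b p p, hp]
    simp only [mul_assoc]
  have h2 : p * b * (c * p) = b * (c * p) := by
    rw [hc, ← mul_assoc, ← mul_assoc, ← mul_assoc, ← mul_assoc, ← hb]
  have h3 : b * p * (p * c) = b * p * c := by rw [← mul_assoc, mul_assoc b p p, hp]
  have h4 : p * b * (p * c) = b * p * c := by rw [← mul_assoc, ← hb]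
  rw [sub_mul, mul_sub, mul_sub, h1, h2, h3, h4, sub_self]

theorem add_smul_commutator_commute (hp : p * p = p) (hb : b * p = p * b * p)
    (hc : c * p = p * c * p) (h : b * c = c * b) (t : ℂ) :
    (b + t • (b * p - p * b)) * (c + t • (c * p - p * c)) =
      (c + t • (c * p - p * c)) * (b + t • (b * p - p * b)) := by
  have key : ∀ a d : R, a * p = p * a * p → d * p = p * d * p →
      (a + t • (a * p - p * a)) * (d + t • (d * p - p * d)) =
        a * d + t • (a * d * p - p * (a * d)) := fun a d ha hd => by
    rw [mul_add, add_mul, add_mul, smul_mul_smul_comm, commutator_mul_commutator hp ha hd,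
      smul_zero, add_zero, smul_mul_assoc, mul_smul_comm, add_assoc, ← smul_add]
    congr 2
    noncomm_ring
  rw [key b c hb hc, key c b hc hb, h]

/-- Conjugation by `p + s⁻¹ (1 - p)` multiplies the block of `b` from the kernel of `p` to its
range by `s`. The first factor on the right makes sense for `s = 0`, where that block is removed.
-/
theorem conj_eq_add_smul_commutator (hp : p * p = p) (hb : b * p = p * b * p) {s : ℂ}
    (hs : s ≠ 0) : (p + s⁻¹ • (1 - p)) * b =
      (b + (1 - s) • (b * p - p * b)) * (p + s⁻¹ • (1 - p)) := by
  have h1 : (b * p - p * b) * p = 0 := by rw [sub_mul, mul_assoc b, hp, ← hb, sub_self]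
  have h2 : (b * p - p * b) * (p + s⁻¹ • (1 - p)) = s⁻¹ • (b * p - p * b) := by
    rw [mul_add, mul_smul_comm, mul_sub, h1, mul_one, sub_zero, zero_add]
  rw [add_mul b, smul_mul_assoc (1 - s), h2, smul_smul, sub_mul 1 s, one_mul, mul_inv_cancel₀ hs,
    add_mul, smul_mul_assoc, sub_mul, one_mul, mul_add, mul_smul_comm, mul_sub, mul_one]
  module

theorem idempotent_unit_mul (hp : p * p = p) {s r : ℂ} (hs : s * r = 1) :
    (p + s • (1 - p)) * (p + r • (1 - p)) = 1 := by
  have h1 : p * (1 - p) = 0 := by rw [mul_sub, mul_one, hp, sub_self]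
  have h2 : (1 - p) * p = 0 := by rw [sub_mul, one_mul, hp, sub_self]
  have h3 : (1 - p) * (1 - p) = 1 - p := by rw [sub_mul, one_mul, h1, sub_zero]
  rw [mul_add, add_mul, add_mul, smul_mul_smul_comm, hs, one_smul, smul_mul_assoc, mul_smul_comm,
    h1, h2, h3, hp, smul_zero, smul_zero, add_zero, zero_add, add_sub_cancel]

end Idempotent

/-- `det (f + s h)` is a polynomial in `s`. -/
theorem exists_polynomial_det [FiniteDimensional ℂ V] (f h : Module.End ℂ V) :
    ∃ P : Polynomial ℂ, ∀ s : ℂ, LinearMap.det (f + s • h) = P.eval s := by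
  let e := Module.finBasis ℂ V
  refine ⟨((LinearMap.toMatrix e e f).map Polynomial.C +
    (Polynomial.X : Polynomial ℂ) • (LinearMap.toMatrix e e h).map Polynomial.C).det, fun s => ?_⟩
  rw [← LinearMap.det_toMatrix e, ← Polynomial.coe_evalRingHom, RingHom.map_det]
  congr 1
  refine Matrix.ext fun i j => ?_
  simp
  exact mul_comm _ _

/-- The orbit of an unstable datum, linearized by `χ`, has a limit point with last coordinate `0`,
obtained from a one-parameter subgroup acting trivially on a destabilizing subspace and by a
nontrivial character on a complement. -/
theorem exists_mem_closure_orbit_coord_eq_zero [FiniteDimensional ℂ V] (hl : 0 < l)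
    {X : Variety n V W} (hX : ¬ X.toDatum.IsStable) (z : ℂ) :
    ∃ P ∈ closure (MulAction.orbit (LinearMap.GeneralLinearGroup ℂ V)
      (⟨X, z⟩ : Linearized n l V W)), P.coord = 0 := by
  obtain ⟨S, hS, hB, hI⟩ := not_not.1 hX
  obtain ⟨T, hT⟩ := S.exists_isCompl
  let p : Module.End ℂ V := S.projection T hT
  have hpS : ∀ v ∈ S, p v = v := fun v hv => Submodule.projection_apply_of_mem_left hT hv
  have hp : p * p = p := LinearMap.ext fun v => hpS _ (Submodule.projection_apply_mem hT v)
  have hb : ∀ i, X.toDatum.B i * p = p * X.toDatum.B i * p := fun i => LinearMap.ext fun v =>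
    (hpS _ (hB i ⟨_, Submodule.projection_apply_mem hT v, rfl⟩)).symm
  have hdet : LinearMap.det p = 0 := by
    by_contra h
    have h2 := LinearMap.range_eq_top.2 ((LinearMap.equivOfDetNeZero p h).surjective)
    exact hS (top_le_iff.1 (h2 ▸ (Submodule.range_projection hT).le))
  obtain ⟨D, hD⟩ := exists_polynomial_det p (1 - p)
  let Y : Datum n V W := (fun i => X.toDatum.B i * p - p * X.toDatum.B i, 0)
  -- for `s ≠ 0` this is the translate by `p + s⁻¹ (1 - p)`, whose inverse has determinant `D(s)`
  let γ : ℂ → Linearized n l V W := fun s =>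
    ⟨⟨X.toDatum + (1 - s) • Y, fun i j =>
      add_smul_commutator_commute hp (hb i) (hb j) (X.2 i j) (1 - s)⟩, D.eval s ^ l * z⟩
  refine ⟨γ 0, ?_, ?_⟩
  · refine mem_closure_of_curve (fun φ => ?_) fun s hs => ?_
    · refine ⟨.C (φ (X.toDatum, 0)) + (1 - .X) * .C (φ (Y, 0)) + D ^ l * .C z * .C (φ (0, 1)),
        fun s => ?_⟩
      have : (((γ s).datum.toDatum, (γ s).coord) : Datum n V W × ℂ) =
          (X.toDatum, 0) + (1 - s) • (Y, 0) + (D.eval s ^ l * z) • (0, 1) := by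
        refine Prod.ext ?_ ?_
        · change X.toDatum + (1 - s) • Y = X.toDatum + (1 - s) • Y + (D.eval s ^ l * z) • 0
          rw [smul_zero, add_zero]
        · simp [γ]
      rw [this, map_add, map_add, map_smul, map_smul]
      simp
    · let g : LinearMap.GeneralLinearGroup ℂ V := ⟨p + s⁻¹ • (1 - p), p + s • (1 - p),
        idempotent_unit_mul hp (inv_mul_cancel₀ hs), idempotent_unit_mul hp (mul_inv_cancel₀ hs)⟩
      refine ⟨g, ?_⟩
      have hdatum : g • X = (γ s).datum := by
        refine Subtype.ext (Prod.ext (funext fun i => ?_) (LinearMap.ext fun w => ?_))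
        · change g.val * X.toDatum.B i * (g⁻¹).val =
            X.toDatum.B i + (1 - s) • (X.toDatum.B i * p - p * X.toDatum.B i)
          rw [Units.mul_inv_eq_iff_eq_mul]
          exact conj_eq_add_smul_commutator hp (hb i) hs
        · change p (X.toDatum.I w) + s⁻¹ • (X.toDatum.I w - p (X.toDatum.I w)) =
            X.toDatum.I w + (1 - s) • (0 : V)
          rw [hpS _ (hI ⟨w, rfl⟩), sub_self, smul_zero, smul_zero]
      have hcoord : (((character l V g)⁻¹ : ℂˣ) : ℂ) * z = (γ s).coord := by
        rw [← map_inv, character_apply]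
        change LinearMap.det (p + s • (1 - p)) ^ l * z = D.eval s ^ l * z
        rw [hD]
      change (⟨g • X, (((character l V g)⁻¹ : ℂˣ) : ℂ) * z⟩ : Linearized n l V W) = γ s
      rw [hdatum, hcoord]
  · change D.eval 0 ^ l * z = 0
    rw [← hD, zero_smul, add_zero, hdet, zero_pow hl.ne', zero_mul]

/-- The regular functions on `𝒱(n, c) × ℂ`, with respect to which its topology is defined. -/
abbrev linearizedFunctions (n l : ℕ) (V W : Type*) [AddCommGroup V] [Module ℂ V] [AddCommGroup W]
    [Module ℂ W] : Subalgebra ℂ (Linearized n l V W → ℂ) :=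
  regularFunctions fun P : Linearized n l V W => ((P.datum.toDatum, P.coord) : Datum n V W × ℂ)

theorem datum_mem_linearizedFunctions (f : Gam n V W) :
    (fun P : Linearized n l V W => f P.datum) ∈ linearizedFunctions n l V W :=
  regularFunctions.comp_mem (φ := Linearized.datum) (LinearMap.fst ℂ (Datum n V W) ℂ)
    (fun _ => rfl) f.2

theorem coord_mem_linearizedFunctions :
    (fun P : Linearized n l V W => P.coord) ∈ linearizedFunctions n l V W :=
  regularFunctions.dual_mem (LinearMap.snd ℂ (Datum n V W) ℂ)

theorem isClosed_eq_zero {h : Linearized n l V W → ℂ} (hh : h ∈ linearizedFunctions n l V W) :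
    IsClosed {P | h P = 0} := by
  rw [← isOpen_compl_iff]
  exact isOpen_ne_zero hh

/-- Semi-invariants of positive weight vanish at unstable data. -/
theorem apply_eq_zero_of_not_isStable [FiniteDimensional ℂ V] (hl : 0 < l) {X : Variety n V W}
    (hX : ¬ X.toDatum.IsStable) {i : ℕ} (hi : 0 < i) {f : Gam n V W}
    (hf : f ∈ semiInvariants n l V W i) : f X = 0 := by
  obtain ⟨P, hP, hP0⟩ := exists_mem_closure_orbit_coord_eq_zero hl hX 1
  -- the invariant function `z ^ i * f` is constant along the orbit, hence along its closure
  let h : Linearized n l V W → ℂ := fun P => P.coord ^ i * f P.datum - f X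
  have hh : h ∈ linearizedFunctions n l V W :=
    sub_mem (mul_mem (pow_mem coord_mem_linearizedFunctions i) (datum_mem_linearizedFunctions f))
      ((linearizedFunctions n l V W).algebraMap_mem (f X))
  have hsub : MulAction.orbit (LinearMap.GeneralLinearGroup ℂ V) (⟨X, 1⟩ : Linearized n l V W) ⊆
      {P | h P = 0} := by
    rintro _ ⟨g, rfl⟩
    change ((((character l V g)⁻¹ : ℂˣ) : ℂ) * 1) ^ i * f (g • X) - f X = 0
    rw [hf g X, mul_one, ← mul_assoc, ← mul_pow, Units.inv_mul, one_pow, one_mul, sub_self]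
  have := closure_minimal hsub (isClosed_eq_zero hh) hP
  change P.coord ^ i * f P.datum - f X = 0 at this
  rw [hP0, zero_pow hi.ne', zero_mul, zero_sub, neg_eq_zero] at this
  exact this

/-! ### Closed orbits -/

/-- A datum of the slice equals `X` as soon as all numerators take there the values prescribed by
`X`, because on the slice every regular function has a numerator. -/
theorem eq_of_mem_slice {ι : Type*} [Fintype ι] [DecidableEq ι] {e : Module.Basis ι ℂ V} {w₀ : W}
    (hl : 0 < l) (hw : ∀ w : W, ∃ c : ℂ, c • w₀ = w) {m : ι → List (Fin n)} {X Y : Variety n V W}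
    (hY : Y ∈ slice e w₀ m)
    (h : ∀ (f : Gam n V W) (N : ℕ) (F : Gam n V W), IsNumerator e w₀ l m f N F → F Y = f X) :
    Y = X :=
  Variety.ext_eval hw fun f => by
    obtain ⟨N, F, hF⟩ := exists_isNumerator hl hw m f
    rw [← hF.2 Y hY, h f N F hF]

theorem isClosed_orbit_iff [FiniteDimensional ℂ V] (hl : 0 < l) {w₀ : W}
    (hw : ∀ w : W, ∃ c : ℂ, c • w₀ = w) (X : Variety n V W) {z : ℂ} (hz : z ≠ 0) :
    IsClosed (MulAction.orbit (LinearMap.GeneralLinearGroup ℂ V) (⟨X, z⟩ : Linearized n l V W)) ↔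
      X.toDatum.IsStable := by
  constructor
  · intro hcl
    by_contra hX
    obtain ⟨P, hP, hP0⟩ := exists_mem_closure_orbit_coord_eq_zero hl hX z
    rw [hcl.closure_eq] at hP
    obtain ⟨g, rfl⟩ := hP
    exact mul_ne_zero (Units.ne_zero _) hz hP0
  · intro hX
    let e := Module.finBasis ℂ V
    obtain ⟨m, hm⟩ := (isStable_iff (e := e) hw X).1 hX
    obtain ⟨g₀, hg₀⟩ := exists_smul_mem_slice hm
    -- move the base point of the orbit to the slice
    generalize hP₀ : g₀ • (⟨X, z⟩ : Linearized n l V W) = P₀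
    have hP₀m : P₀.datum ∈ slice e w₀ m := by rw [← hP₀]; exact hg₀
    have hP₀z : P₀.coord ≠ 0 := by rw [← hP₀]; exact mul_ne_zero (Units.ne_zero _) hz
    have horb : MulAction.orbit (LinearMap.GeneralLinearGroup ℂ V) (⟨X, z⟩ : Linearized n l V W) =
        MulAction.orbit (LinearMap.GeneralLinearGroup ℂ V) P₀ := by
      rw [← hP₀, MulAction.orbit_smul]
    let d : Gam n V W := (semiDet e w₀ l m).1
    have hd : d ∈ semiInvariants n l V W 1 := (semiDet e w₀ l m).2
    have horb2 : MulAction.orbit (LinearMap.GeneralLinearGroup ℂ V) P₀ =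
        {P | P.coord * d P.datum - P₀.coord = 0} ∩ ⋂ (f : Gam n V W) (N : ℕ) (F : Gam n V W)
          (_ : IsNumerator e w₀ l m f N F),
            {P | F P.datum - d P.datum ^ N * f P₀.datum = 0} := by
      refine Set.Subset.antisymm ?_ ?_
      · rintro _ ⟨g, rfl⟩
        refine ⟨?_, ?_⟩
        · change (((character l V g)⁻¹ : ℂˣ) : ℂ) * P₀.coord * d (g • P₀.datum) - P₀.coord = 0
          rw [hd g, semiDet_of_mem_slice hP₀m, mul_one, pow_one, mul_right_comm, Units.inv_mul,
            one_mul, sub_self]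
        · simp only [Set.mem_iInter]
          intro f N F hF
          change F (g • P₀.datum) - d (g • P₀.datum) ^ N * f P₀.datum = 0
          rw [hF.1 g, hd g, semiDet_of_mem_slice hP₀m, mul_one, pow_one, hF.2 _ hP₀m, sub_self]
      · rintro P ⟨h1, h2⟩
        simp only [Set.mem_iInter] at h2
        replace h1 : P.coord * d P.datum = P₀.coord := sub_eq_zero.1 h1
        replace h2 : ∀ f N F, IsNumerator e w₀ l m f N F →
            F P.datum = d P.datum ^ N * f P₀.datum := fun f N F hF => sub_eq_zero.1 (h2 f N F hF)
        have hdP : frameDet e w₀ m P.datum ≠ 0 := fun h => hP₀z (by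
          rw [← h1, semiDet_apply, h, zero_pow hl.ne', mul_zero])
        obtain ⟨g, hg⟩ := exists_smul_mem_slice hdP
        have hdg : (character l V g : ℂ) * d P.datum = 1 := by
          rw [← semiDet_of_mem_slice (l := l) hg, (semiDet e w₀ l m).2 g, pow_one]
        have hdatum : g • P.datum = P₀.datum := eq_of_mem_slice hl hw hg fun f N F hF => by
          rw [hF.1 g, h2 f N F hF, ← mul_assoc, ← mul_pow, hdg, one_pow, one_mul]
        have hcoord : (((character l V g)⁻¹ : ℂˣ) : ℂ) * P.coord = P₀.coord := by
          rw [← h1, mul_comm, Units.mul_inv_eq_iff_eq_mul, mul_assoc, mul_comm (d _), hdg, mul_one]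
        have : g • P = P₀ := by
          change (⟨g • P.datum, (((character l V g)⁻¹ : ℂˣ) : ℂ) * P.coord⟩ :
            Linearized n l V W) = P₀
          rw [hdatum, hcoord]
        exact ⟨g⁻¹, by rw [← this]; exact inv_smul_smul g P⟩
    rw [horb, horb2]
    refine IsClosed.inter (isClosed_eq_zero (sub_mem (mul_mem coord_mem_linearizedFunctions
      (datum_mem_linearizedFunctions d)) ((linearizedFunctions n l V W).algebraMap_mem _))) ?_
    refine isClosed_iInter fun f => isClosed_iInter fun N => isClosed_iInter fun F =>
      isClosed_iInter fun _ => isClosed_eq_zero ?_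
    exact sub_mem (datum_mem_linearizedFunctions F) (mul_mem
      (pow_mem (datum_mem_linearizedFunctions d) N)
      ((linearizedFunctions n l V W).algebraMap_mem _))

/-! ### Valuation rings and lattices -/

/-- A ring homomorphism to a field whose kernel lies in a prime ideal `p` admits a valuation ring
of the field that contains the image and whose maximal ideal contracts to `p`. -/
theorem exists_valuationSubring_of_ker_le {R K : Type*} [CommRing R] [Field K] (φ : R →+* K)
    (p : Ideal R) [p.IsPrime] (h : RingHom.ker φ ≤ p) :
    ∃ O : ValuationSubring K, (∀ r, φ r ∈ O) ∧ (∀ r ∈ p, O.valuation (φ r) < 1) ∧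
      ∀ r ∉ p, O.valuation (φ r) = 1 := by
  have hu : ∀ y : p.primeCompl, IsUnit (φ y) := fun y =>
    Ne.isUnit fun hy => y.2 (h (RingHom.mem_ker.2 hy))
  let ψ : Localization.AtPrime p →+* K := IsLocalization.lift hu
  have hψ : ∀ r, ψ (algebraMap R _ r) = φ r := fun r => IsLocalization.lift_eq hu r
  obtain ⟨O, hO, hloc⟩ := (LocalSubring.range ψ).exists_le_valuationSubring
  have hmem : ∀ x, ψ x ∈ O := fun x => hO ⟨x, rfl⟩
  have hφ : ∀ r, φ r ∈ O := fun r => hψ r ▸ hmem _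
  refine ⟨O, hφ, fun r hr => ?_, fun r hr => ?_⟩
  · refine (O.valuation_lt_one_or_eq_one ⟨φ r, hφ r⟩).resolve_right fun h1 => ?_
    rw [← O.valuation_eq_one_iff] at h1
    have h2 : IsUnit (⟨φ r, ⟨algebraMap R _ r, hψ r⟩⟩ : (LocalSubring.range ψ).toSubring) :=
      hloc.map_nonunit _ h1
    obtain ⟨⟨_, x, rfl⟩, hx⟩ := isUnit_iff_exists_inv.1 h2
    have hx' : φ r * ψ x = 1 := congrArg Subtype.val hx
    have hmax : algebraMap R (Localization.AtPrime p) r * x ∈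
        IsLocalRing.maximalIdeal (Localization.AtPrime p) :=
      Ideal.mul_mem_right _ _ ((IsLocalization.AtPrime.to_map_mem_maximal_iff _ p r).2 hr)
    have hunit : IsUnit (1 - algebraMap R (Localization.AtPrime p) r * x) :=
      (IsLocalRing.isUnit_or_isUnit_one_sub_self _).resolve_left
        ((IsLocalRing.mem_maximalIdeal _).1 hmax)
    have := hunit.map ψ
    rw [map_sub, map_one, map_mul, hψ, hx', sub_self] at this
    exact not_isUnit_zero this
  · obtain ⟨y, hy⟩ : ∃ y : p.primeCompl, (y : R) = r := ⟨⟨r, hr⟩, rfl⟩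
    have h1 : φ r * ψ (IsLocalization.mk' _ 1 y) = 1 := by
      rw [← hψ, ← map_mul, ← hy, IsLocalization.mul_mk'_eq_mk'_of_mul, mul_one,
        IsLocalization.mk'_self', map_one]
    refine (O.valuation_eq_one_iff ⟨φ r, hφ r⟩).1
      (isUnit_iff_exists_inv.2 ⟨⟨_, hmem (IsLocalization.mk' _ 1 y)⟩, ?_⟩)
    exact Subtype.ext h1

/-- The vectors obtained from `v` by applying words in the operators `T i`. -/
def wordVec {α M : Type*} (T : α → M → M) (v : M) : List α → M
  | [] => v
  | i :: w => T i (wordVec T v w)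

/-- Commuting integral operators generate a finitely generated module from any vector. -/
theorem fg_span_wordVec {O M α : Type*} [Finite α] [CommRing O] [AddCommGroup M] [Module O M]
    (T : α → Module.End O M) (hcomm : ∀ i j, Commute (T i) (T j)) (hint : ∀ i, IsIntegral O (T i))
    (v : M) : (Submodule.span O (Set.range (wordVec (fun i => T i) v))).FG := by
  classical
  have := Fintype.ofFinite α
  set L := Submodule.span O (Set.range (wordVec (fun i => T i) v)) with hL
  have hTL : ∀ i, L ≤ L.comap (T i) := fun i => by
    rw [hL, Submodule.span_le]
    rintro _ ⟨w, rfl⟩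
    exact Submodule.subset_span ⟨i :: w, rfl⟩
  -- close up under the operators one at a time
  have key : ∀ s : Finset α, ∃ N : Submodule O M, N.FG ∧ v ∈ N ∧ N ≤ L ∧
      ∀ i ∈ s, N ≤ N.comap (T i) := fun s => by
    induction s using Finset.induction_on with
    | empty =>
      exact ⟨O ∙ v, Submodule.fg_span_singleton v, Submodule.mem_span_singleton_self v,
        (Submodule.span_singleton_le_iff_mem _ _).2 (Submodule.subset_span ⟨[], rfl⟩), by simp⟩
    | insert a s _ ih =>
      obtain ⟨N, hfg, hv, hNL, hN⟩ := ih
      let A := Algebra.adjoin O {T a}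
      have hAL : ∀ S ∈ A, L ≤ L.comap S := fun S hS => by
        induction hS using Algebra.adjoin_induction with
        | mem S hS => rw [Set.mem_singleton_iff.1 hS]; exact hTL a
        | algebraMap r => exact fun x hx => L.smul_mem r hx
        | add S S' _ _ h h' => exact fun x hx => L.add_mem (h hx) (h' hx)
        | mul S S' _ _ h h' => exact fun x hx => h (h' hx)
      have hAcomm : ∀ i, ∀ S ∈ A, Commute (T i) S := fun i S hS => by
        induction hS using Algebra.adjoin_induction with
        | mem S hS => rw [Set.mem_singleton_iff.1 hS]; exact hcomm i a
        | algebraMap r => exact (Algebra.commutes r _).symm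
        | add S S' _ _ h h' => exact h.add_right h'
        | mul S S' _ _ h h' => exact h.mul_right h'
      let f : Module.End O M →ₗ[O] M →ₗ[O] M := LinearMap.id
      refine ⟨Submodule.map₂ f (Subalgebra.toSubmodule A) N,
        (IsIntegral.fg_adjoin_singleton (hint a)).map₂ f hfg, ?_, ?_, fun i hi => ?_⟩
      · exact Submodule.apply_mem_map₂ f (show 1 ∈ Subalgebra.toSubmodule A from one_mem A) hv
      · exact Submodule.map₂_le.2 fun S hS x hx => hAL S hS (hNL hx)
      · refine Submodule.map₂_le.2 fun S hS x hx => ?_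
        change T i (S x) ∈ Submodule.map₂ f (Subalgebra.toSubmodule A) N
        rcases Finset.mem_insert.1 hi with rfl | hi
        · have hTS : T i * S ∈ A := mul_mem (Algebra.self_mem_adjoin_singleton O (T i)) hS
          have h := Submodule.apply_mem_map₂ f (p := Subalgebra.toSubmodule A) hTS hx
          exact h
        · have hTx : T i x ∈ N := hN i hi hx
          have h := Submodule.apply_mem_map₂ f (p := Subalgebra.toSubmodule A) hS hTx
          rw [← Module.End.mul_apply, (hAcomm i S hS).eq]
          exact h
  obtain ⟨N, hfg, hv, hNL, hN⟩ := key Finset.univ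
  have hLN : L ≤ N := Submodule.span_le.2 (by
    rintro _ ⟨w, rfl⟩
    induction w with
    | nil => exact hv
    | cons i w ih => exact hN i (Finset.mem_univ i) ih)
  rwa [hLN.antisymm hNL]

section Lattice

variable {K : Type*} [Field K] (O : ValuationSubring K) {ι α : Type*} [Fintype ι] [DecidableEq ι]

theorem isIntegral_of_charpoly_coeff_mem {B : Matrix ι ι K} (h : ∀ t, B.charpoly.coeff t ∈ O) :
    IsIntegral O ((Matrix.toLin' B).restrictScalars O : Module.End O (ι → K)) := by
  have h1 : IsIntegral O B := by
    have hlift : B.charpoly ∈ Polynomial.lifts (algebraMap O K) :=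
      (Polynomial.lifts_iff_coeff_lifts _).2 fun t => ⟨⟨_, h t⟩, rfl⟩
    obtain ⟨P, hP, -, hmonic⟩ := Polynomial.lifts_and_degree_eq_and_monic hlift B.charpoly_monic
    refine ⟨P, hmonic, ?_⟩
    rw [← Polynomial.aeval_def, ← Polynomial.aeval_map_algebraMap K, hP, Matrix.aeval_self_charpoly]
  have h2 : IsIntegral O (Matrix.toLinAlgEquiv' B) :=
    h1.map ((Matrix.toLinAlgEquiv' (R := K) (n := ι)).restrictScalars O)
  exact h2.map (Algebra.lsmul O O (ι → K))

/-- Among the bases consisting of words applied to `v`, one with determinant of maximal valuation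
spans over `O` the module generated by all words, in the sense of Cramer's rule. -/
theorem exists_det_update_div_mem [Finite α] (B : α → Matrix ι ι K)
    (hcomm : ∀ i j, B i * B j = B j * B i)
    (hB : ∀ i t, (B i).charpoly.coeff t ∈ O) (v : ι → K) (m₀ : ι → List α)
    (hm₀ : (Matrix.of fun j k => wordVec (fun i => (B i).mulVec) v (m₀ k) j).det ≠ 0) :
    ∃ m : ι → List α, (Matrix.of fun j k => wordVec (fun i => (B i).mulVec) v (m k) j).det ≠ 0 ∧
      ∀ j w, (Matrix.of fun j' k =>
          wordVec (fun i => (B i).mulVec) v (Function.update m j w k) j').det /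
        (Matrix.of fun j k => wordVec (fun i => (B i).mulVec) v (m k) j).det ∈ O := by
  classical
  set u : List α → ι → K := wordVec (fun i => (B i).mulVec) v with hu
  set δ : (ι → List α) → K := fun m => (Matrix.of fun j k => u (m k) j).det with hδ
  have hfg : (Submodule.span O (Set.range u)).FG := by
    refine fg_span_wordVec (fun i => (Matrix.toLin' (B i)).restrictScalars O) (fun i j => ?_)
      (fun i => isIntegral_of_charpoly_coeff_mem O (hB i)) v
    refine LinearMap.ext fun x => ?_
    change (B i).mulVec ((B j).mulVec x) = (B j).mulVec ((B i).mulVec x)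
    rw [Matrix.mulVec_mulVec, Matrix.mulVec_mulVec, hcomm]
  obtain ⟨t, ht, htspan⟩ := (Submodule.fg_span_iff_fg_span_finset_subset _).1 hfg
  choose f hf using fun x : t => ht x.2
  let S : Finset (List α) := Finset.univ.image f ∪ Finset.univ.image m₀
  have hS : ∀ w, u w ∈ Submodule.span O (u '' S) := fun w => by
    have h1 : u w ∈ Submodule.span O (t : Set (ι → K)) := htspan ▸ Submodule.subset_span ⟨w, rfl⟩
    refine Submodule.span_mono (fun x hx => ?_) h1
    exact ⟨f ⟨x, hx⟩, Finset.mem_coe.2 (Finset.mem_union_left _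
      (Finset.mem_image_of_mem _ (Finset.mem_univ _))), hf ⟨x, hx⟩⟩
  have hm₀S : m₀ ∈ Fintype.piFinset fun _ : ι => S := Fintype.mem_piFinset.2 fun k =>
    Finset.mem_union_right _ (Finset.mem_image_of_mem _ (Finset.mem_univ _))
  obtain ⟨m, hm, hmax⟩ := Finset.exists_max_image (Fintype.piFinset fun _ : ι => S)
    (fun m => O.valuation (δ m)) ⟨m₀, hm₀S⟩
  have hδm : δ m ≠ 0 := fun h => by
    have := hmax m₀ hm₀S
    rw [h, map_zero, le_zero_iff, map_eq_zero] at this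
    exact hm₀ this
  refine ⟨m, hδm, fun j w => ?_⟩
  have hupd : ∀ w, δ (Function.update m j w) =
      Matrix.cramer (Matrix.of fun j k => u (m k) j) (u w) j := fun w => by
    rw [Matrix.cramer_apply]
    refine congrArg Matrix.det ?_
    refine Matrix.ext fun a b => ?_
    rcases eq_or_ne b j with rfl | hb
    · simp
    · simp [hb]
  change δ (Function.update m j w) / δ m ∈ O
  rw [hupd]
  have hx := hS w
  generalize u w = x at hx ⊢
  induction hx using Submodule.span_induction with
  | mem x hx =>
    obtain ⟨w', hw', rfl⟩ := hx
    rw [← hupd, ← O.valuation_le_one_iff, map_div₀]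
    refine div_le_one_of_le₀ (hmax _ (Fintype.mem_piFinset.2 fun k => ?_)) zero_le
    rcases eq_or_ne k j with rfl | hk
    · simpa using hw'
    · simpa [hk] using Fintype.mem_piFinset.1 hm k
  | zero => rw [map_zero, Pi.zero_apply, zero_div]; exact zero_mem O
  | add x y _ _ hx hy => rw [map_add, Pi.add_apply, add_div]; exact add_mem hx hy
  | smul a x _ hx =>
    have : a • x = (a : K) • x := rfl
    rw [this, map_smul, Pi.smul_apply, smul_eq_mul, mul_div_assoc]
    exact mul_mem a.2 hx

end Lattice

/-! ### The determinantal semi-invariants have no common zero on the GIT quotient -/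

/-- A semi-invariant of weight `χ^i`, as a homogeneous element of the ring of semi-invariants. -/
abbrev homog {i : ℕ} (f : semiInvariants n l V W i) : SemiInvariantRing n l V W :=
  (toPiece f : piece n l V W i)

theorem homog_val {i : ℕ} (f : semiInvariants n l V W i) :
    (homog f).1 = Polynomial.monomial i f.1 := rfl

theorem homog_mul {i j k : ℕ} (f : semiInvariants n l V W i) (g : semiInvariants n l V W j)
    (h : semiInvariants n l V W k) (hk : i + j = k) (hfg : h.1 = f.1 * g.1) :
    homog h = homog f * homog g := by
  subst hk
  refine Subtype.ext ?_
  change Polynomial.monomial (i + j) h.1 = Polynomial.monomial i f.1 * Polynomial.monomial j g.1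
  rw [Polynomial.monomial_mul_monomial, hfg]

theorem homog_add {i : ℕ} (f g : semiInvariants n l V W i) :
    homog (f + g) = homog f + homog g :=
  Subtype.ext (map_add (Polynomial.monomial i) f.1 g.1)

theorem homog_coeff {i : ℕ} (P : piece n l V W i) :
    homog ⟨P.1.1.coeff i, P.1.2 i⟩ = P.1 :=
  congrArg Subtype.val (toPiece_coeff n l V W P)

theorem exists_homog_notMem (p : ProjectiveSpectrum (piece n l V W)) :
    ∃ i > 0, ∃ f : semiInvariants n l V W i, homog f ∉ p.asHomogeneousIdeal := by
  have h := p.not_irrelevant_le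
  rw [HomogeneousIdeal.irrelevant_le] at h
  push Not at h
  obtain ⟨i, hi, hp⟩ := h
  obtain ⟨a, ha, hap⟩ := Set.not_subset.1 hp
  refine ⟨i, hi, ⟨a.1.coeff i, a.2 i⟩, fun hmem => hap ?_⟩
  rwa [homog_coeff ⟨a, ha⟩] at hmem

section Frame

variable {ι : Type*} [Fintype ι] [DecidableEq ι] {e : Module.Basis ι ℂ V} {w₀ : W}

theorem charpoly_coeff_apply (i : Fin n) (t : ℕ) (X : Variety n V W) :
    (genB e W i).charpoly.coeff t X =
      (LinearMap.toMatrix e e (X.toDatum.B i)).charpoly.coeff t := by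
  have h : (genB e W i).map (Gam.eval X : Gam n V W →+* ℂ) =
      LinearMap.toMatrix e e (X.toDatum.B i) := Matrix.ext fun j k => by
    rw [LinearMap.toMatrix_apply]
    rfl
  rw [← h, Matrix.charpoly_map, Polynomial.coeff_map]
  rfl

theorem charpoly_coeff_mem_semiInvariants (e : Module.Basis ι ℂ V) (i : Fin n) (t : ℕ) :
    (genB e W i).charpoly.coeff t ∈ semiInvariants n l V W 0 := by
  intro g X
  have := Module.Finite.of_basis e
  rw [pow_zero, one_mul, charpoly_coeff_apply, charpoly_coeff_apply, LinearMap.charpoly_toMatrix,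
    LinearMap.charpoly_toMatrix,
    ← LinearEquiv.charpoly_conj (LinearMap.GeneralLinearGroup.generalLinearEquiv ℂ V g)
      (X.toDatum.B i)]
  rfl

theorem map_genWord {K : Type*} [CommRing K] (ψ : Gam n V W →+* K) (w : List (Fin n)) (j : ι) :
    ψ (genWord e w₀ w j) =
      wordVec (fun i => ((genB e W i).map ψ).mulVec) (ψ ∘ genI e w₀ n) w j := by
  induction w generalizing j with
  | nil => rfl
  | cons i w ih =>
    rw [genWord, wordVec, RingHom.map_mulVec]
    congr 1
    exact funext ih

theorem map_frameDet {K : Type*} [CommRing K] (ψ : Gam n V W →+* K) (m : ι → List (Fin n)) :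
    ψ (frameDet e w₀ m) = (Matrix.of fun j k =>
      wordVec (fun i => ((genB e W i).map ψ).mulVec) (ψ ∘ genI e w₀ n) (m k) j).det := by
  rw [frameDet, RingHom.map_det]
  exact congrArg _ (Matrix.ext fun j k => map_genWord ψ (m k) j)

/-- Let `O` be a valuation ring of a field over which a datum is given, containing the values of
the invariants. Take the determinantal semi-invariant `d` with maximal valuation. The fractions `F
/ d ^ N` that define the regular functions on the slice of `d` take values in `O`, since they are
generated by quotients of determinants. -/
theorem exists_numerator_div_mem {K : Type*} [Field K] (O : ValuationSubring K)
    (ψ : Gam n V W →+* K) (hl : 0 < l) (hw : ∀ w : W, ∃ c : ℂ, c • w₀ = w)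
    (hψ : ∀ h ∈ semiInvariants n l V W 0, ψ h ∈ O) {m₀ : ι → List (Fin n)}
    (hm₀ : ψ (frameDet e w₀ m₀) ≠ 0) :
    ∃ m, ψ (semiDet e w₀ l m).1 ≠ 0 ∧ ∀ f, ∃ N F, IsNumerator e w₀ l m f N F ∧
      ψ F / ψ (semiDet e w₀ l m).1 ^ N ∈ O := by
  rw [map_frameDet] at hm₀
  obtain ⟨m, hm, hmO⟩ := exists_det_update_div_mem O (fun i => (genB e W i).map ψ)
    (fun i j => by rw [← Matrix.map_mul, ← Matrix.map_mul, genB_comm])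
    (fun i t => by
      rw [Matrix.charpoly_map, Polynomial.coeff_map]
      exact hψ _ (charpoly_coeff_mem_semiInvariants e i t))
    (ψ ∘ genI e w₀ n) m₀ hm₀
  simp only [← map_frameDet] at hm hmO
  have hψd : ψ (semiDet e w₀ l m).1 = ψ (frameDet e w₀ m) ^ l := map_pow ψ _ l
  have hψd0 : ψ (semiDet e w₀ l m).1 ≠ 0 := by rw [hψd]; exact pow_ne_zero _ hm
  refine ⟨m, hψd0, fun f => ?_⟩
  generalize hd : (semiDet e w₀ l m).1 = d at hψd hψd0 ⊢
  refine exists_isNumerator_and hl hw m (fun N F => ψ F / ψ d ^ N ∈ O) (fun j w => ?_)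
    (fun r => ?_) (fun N N' F F' h h' => ?_) (fun N N' F F' h h' => ?_) f
  · obtain ⟨k, rfl⟩ := Nat.exists_eq_succ_of_ne_zero hl.ne'
    rw [map_mul, map_pow, pow_one, hψd, Nat.succ_sub_one, pow_succ,
      mul_div_mul_left _ _ (pow_ne_zero _ hm)]
    exact hmO j w
  · rw [pow_zero, div_one]
    refine hψ _ fun g X => ?_
    rw [pow_zero, one_mul]; rfl
  · have hN := pow_ne_zero N hψd0
    have hN' := pow_ne_zero N' hψd0
    have : ψ (F * d ^ N' + F' * d ^ N) / ψ d ^ (N + N') = ψ F / ψ d ^ N + ψ F' / ψ d ^ N' := by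
      rw [map_add, map_mul, map_mul, map_pow, map_pow, pow_add, div_add_div _ _ hN hN',
        mul_comm (ψ F')]
    rw [hd, this]
    exact add_mem h h'
  · have : ψ (F * F') / ψ d ^ (N + N') = ψ F / ψ d ^ N * (ψ F' / ψ d ^ N') := by
      rw [map_mul, pow_add, mul_div_mul_comm]
    rw [this]
    exact mul_mem h h'

/-- A semi-invariant of weight `χ^i` is a numerator of itself, so that its value is the product of
an element of `O` with `d ^ i`. -/
theorem exists_mul_pow_eq_of_numerator {K : Type*} [Field K] {O : ValuationSubring K}
    {ψ : Gam n V W →+* K} (hl : 0 < l) {m : ι → List (Fin n)}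
    (hd : ψ (semiDet e w₀ l m).1 ≠ 0)
    (h : ∀ f, ∃ N F, IsNumerator e w₀ l m f N F ∧ ψ F / ψ (semiDet e w₀ l m).1 ^ N ∈ O) {i : ℕ}
    {f : Gam n V W} (hf : f ∈ semiInvariants n l V W i) :
    ∃ c ∈ O, ψ f = c * ψ (semiDet e w₀ l m).1 ^ i := by
  obtain ⟨N, F, hF, hFO⟩ := h f
  refine ⟨_, hFO, ?_⟩
  have h1 := congrArg ψ (hF.semiDet_mul_eq hl (IsNumerator.of_semiInvariant hf))
  rw [map_mul, map_mul, map_mul, map_mul, map_pow, map_pow] at h1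
  rw [div_mul_eq_mul_div, eq_div_iff (pow_ne_zero _ hd)]
  exact (mul_left_cancel₀ hd h1).symm

/-- The determinantal semi-invariants have no common zero on the GIT quotient.

Let `f z^i`, `i > 0`, be homogeneous and not in the prime `p`. A minimal prime below `p` is
contracted from a prime of the polynomial ring over all regular functions, and the residue field
of the latter carries a datum `X`. It contains a valuation ring `O` that dominates the local ring
at `p`. If `d` is the determinantal semi-invariant with maximal valuation at `X`, then all
fractions `F / d^N` that define regular functions on the slice of `d` take values in `O`, and `f`
is the product of such a fraction with `d^i`. Hence `d z ∈ p` would imply `f z^i ∈ p`. -/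
theorem exists_semiDet_notMem [FiniteDimensional ℂ V] (hl : 0 < l)
    (hw : ∀ w : W, ∃ c : ℂ, c • w₀ = w) (hw₀ : w₀ ≠ 0) (e : Module.Basis ι ℂ V)
    (p : ProjectiveSpectrum (piece n l V W)) :
    ∃ m, homog (semiDet e w₀ l m) ∉ p.asHomogeneousIdeal := by
  by_contra! hall
  obtain ⟨i, hi, f, hf⟩ := exists_homog_notMem p
  obtain ⟨q, hq, hqp⟩ := Ideal.exists_minimalPrimes_le (I := ⊥) (J := p.asHomogeneousIdeal.toIdeal)
    bot_le
  obtain ⟨Q, hQ, hQq⟩ := Ideal.exists_comap_eq_of_mem_minimalPrimes_of_injective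
    (f := (SemiInvariantRing n l V W).val.toRingHom) Subtype.val_injective q hq
  let Φ : Polynomial (Gam n V W) →+* FractionRing (Polynomial (Gam n V W) ⧸ Q) :=
    (algebraMap _ _).comp (Ideal.Quotient.mk Q)
  have hΦ : ∀ P, Φ P = 0 ↔ P ∈ Q := fun P => by
    rw [← Ideal.Quotient.eq_zero_iff_mem]
    exact map_eq_zero_iff _
      (IsFractionRing.injective (Polynomial (Gam n V W) ⧸ Q)
        (FractionRing (Polynomial (Gam n V W) ⧸ Q)))
  let ψ : Gam n V W →+* FractionRing (Polynomial (Gam n V W) ⧸ Q) := Φ.comp Polynomial.C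
  have hmon : ∀ (j : ℕ) (h : semiInvariants n l V W j),
      Φ (homog h).1 = ψ h.1 * Φ Polynomial.X ^ j := fun j h => by
    rw [homog_val, ← Polynomial.C_mul_X_pow_eq_monomial, map_mul, map_pow]
    rfl
  have hker : RingHom.ker (Φ.comp (SemiInvariantRing n l V W).val.toRingHom) ≤
      p.asHomogeneousIdeal.toIdeal := fun a ha => by
    refine hqp ?_
    rw [← hQq]
    exact (hΦ _).1 ha
  obtain ⟨O, hO, hOp, hOu⟩ := exists_valuationSubring_of_ker_le _ _ hker
  replace hO : ∀ a : SemiInvariantRing n l V W, Φ a.1 ∈ O := hO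
  have hψ0 : ∀ h ∈ semiInvariants n l V W 0, ψ h ∈ O := fun h hh => by
    have := hO (homog ⟨h, hh⟩)
    rwa [hmon, pow_zero, mul_one] at this
  -- some determinant is nonzero in the residue field, by the Nullstellensatz
  have hfQ : f.1 ∉ Q.comap Polynomial.C := fun h => by
    have h0 : ψ f.1 = 0 := (hΦ _).2 h
    have h1 : Φ (homog f).1 = 0 := by rw [hmon, h0, zero_mul]
    exact hf (hker h1)
  obtain ⟨X, hXQ, hXf⟩ := exists_zero_of_notMem_prime hw hw₀ (Q.comap Polynomial.C) hfQ
  have hX : X.toDatum.IsStable := by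
    by_contra hX
    exact hXf (apply_eq_zero_of_not_isStable hl hX hi f.2)
  obtain ⟨m₀, hm₀⟩ := (isStable_iff (e := e) hw X).1 hX
  have hψm₀ : ψ (frameDet e w₀ m₀) ≠ 0 := fun h => hm₀ (hXQ _ ((hΦ _).1 h))
  obtain ⟨m, hm, hmO⟩ := exists_numerator_div_mem O ψ hl hw hψ0 hψm₀
  obtain ⟨c, hc, hfc⟩ := exists_mul_pow_eq_of_numerator hl hm hmO f.2
  have h3 : Φ (homog f).1 = c * Φ (homog (semiDet e w₀ l m)).1 ^ i := by
    rw [hmon, hmon, hfc, pow_one, mul_pow, mul_assoc]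
  refine (?_ : O.valuation (Φ (homog f).1) < 1).ne (hOu _ hf)
  have h5 : O.valuation (Φ (homog (semiDet e w₀ l m)).1) < 1 := hOp _ (hall m)
  rw [h3, map_mul, map_pow]
  exact (mul_le_of_le_one_left' ((O.valuation_le_one_iff _).2 hc)).trans_lt
    (pow_lt_one₀ zero_le h5 hi.ne')

end Frame

/-! ### Points of the GIT quotient and stable data -/

theorem homog_mk_mul {i j : ℕ} (f : semiInvariants n l V W i) (g : semiInvariants n l V W j) :
    homog ⟨f.1 * g.1, SetLike.mul_mem_graded f.2 g.2⟩ = homog f * homog g :=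
  homog_mul f g _ rfl rfl

theorem homog_congr {i j : ℕ} {f : semiInvariants n l V W i} {g : semiInvariants n l V W j}
    (h : i = j) (hfg : f.1 = g.1) : homog f = homog g := by
  subst h
  rw [Subtype.ext hfg]

theorem mem_asHomogeneousIdeal_iff (p : ProjectiveSpectrum (piece n l V W))
    (a : SemiInvariantRing n l V W) :
    a ∈ p.asHomogeneousIdeal ↔ ∀ i, homog ⟨a.1.coeff i, a.2 i⟩ ∈ p.asHomogeneousIdeal := by
  have h : ∀ i, ((DirectSum.decompose (piece n l V W) a i : piece n l V W i) :
      SemiInvariantRing n l V W) = homog ⟨a.1.coeff i, a.2 i⟩ :=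
    fun i => congrArg Subtype.val (components_apply n l V W a i)
  classical
  constructor
  · intro ha i
    rw [← h]
    exact p.asHomogeneousIdeal.2 i ha
  · intro ha
    rw [← DirectSum.sum_support_decompose (piece n l V W) a]
    exact sum_mem fun i _ => by rw [h]; exact ha i

theorem exists_homog_coeff_notMem {p : GITQuotient n l V W} {a : SemiInvariantRing n l V W}
    (ha : ¬ a ∈ p.asHomogeneousIdeal) : ∃ i, homog ⟨a.1.coeff i, a.2 i⟩ ∉ p.asHomogeneousIdeal :=
  not_forall.1 fun h => ha ((mem_asHomogeneousIdeal_iff p a).2 h)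

/-- The ideal of the elements all of whose homogeneous components vanish at a datum. -/
def vanishingIdeal (l : ℕ) (X : Variety n V W) : Ideal (SemiInvariantRing n l V W) :=
  RingHom.ker ((Polynomial.mapRingHom (Gam.eval X : Gam n V W →+* ℂ)).comp
    (SemiInvariantRing n l V W).val.toRingHom)

theorem mem_vanishingIdeal {X : Variety n V W} {a : SemiInvariantRing n l V W} :
    a ∈ vanishingIdeal l X ↔ ∀ i, a.1.coeff i X = 0 := by
  rw [vanishingIdeal, RingHom.mem_ker]
  change Polynomial.map (Gam.eval X : Gam n V W →+* ℂ) a.1 = 0 ↔ _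
  rw [Polynomial.ext_iff]
  refine forall_congr' fun i => ?_
  rw [Polynomial.coeff_map, Polynomial.coeff_zero]
  rfl

instance (X : Variety n V W) : (vanishingIdeal l X).IsPrime :=
  RingHom.ker_isPrime _

theorem homog_mem_vanishingIdeal {X : Variety n V W} {i : ℕ} {f : semiInvariants n l V W i} :
    homog f ∈ vanishingIdeal l X ↔ f.1 X = 0 := by
  rw [mem_vanishingIdeal]
  constructor
  · intro h
    have := h i
    rwa [homog_val, Polynomial.coeff_monomial_same] at this
  · intro h j
    rw [homog_val, Polynomial.coeff_monomial]
    split_ifs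
    · exact h
    · rfl

theorem vanishingIdeal_isHomogeneous (X : Variety n V W) :
    (vanishingIdeal l X).IsHomogeneous (piece n l V W) := by
  intro i a ha
  change (components n l V W a i).1 ∈ vanishingIdeal l X
  rw [components_apply]
  exact homog_mem_vanishingIdeal.2 (mem_vanishingIdeal.1 ha i)

theorem IsImage.homog_mem_iff {X : Variety n V W} {p : GITQuotient n l V W} (h : IsImage X p)
    {i : ℕ} {f : semiInvariants n l V W i} : homog f ∈ p.asHomogeneousIdeal ↔ f.1 X = 0 :=
  (h _).trans (mem_vanishingIdeal.symm.trans homog_mem_vanishingIdeal)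

theorem IsImage.unique {X : Variety n V W} {p q : GITQuotient n l V W} (hp : IsImage X p)
    (hq : IsImage X q) : p = q :=
  ProjectiveSpectrum.ext (HomogeneousIdeal.ext (Ideal.ext fun a => (hp a).trans (hq a).symm))

theorem IsImage.smul {X : Variety n V W} {p : GITQuotient n l V W} (h : IsImage X p)
    (g : LinearMap.GeneralLinearGroup ℂ V) : IsImage (g • X) p := fun a => by
  rw [h a]
  refine forall_congr' fun i => ?_
  rw [a.2 i g X, mul_eq_zero, or_iff_right (pow_ne_zero _ (Units.ne_zero _))]

section Frame

variable {ι : Type*} [Fintype ι] [DecidableEq ι] {e : Module.Basis ι ℂ V} {w₀ : W}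

theorem exists_isImage [FiniteDimensional ℂ V] (hw : ∀ w : W, ∃ c : ℂ, c • w₀ = w)
    {X : Variety n V W} (hX : X.toDatum.IsStable) : ∃ p : GITQuotient n l V W, IsImage X p := by
  obtain ⟨m, hm⟩ := (isStable_iff (e := Module.finBasis ℂ V) hw X).1 hX
  refine ⟨(⟨⟨vanishingIdeal l X, vanishingIdeal_isHomogeneous X⟩,
    inferInstanceAs (vanishingIdeal l X).IsPrime, fun h => ?_⟩ :
      ProjectiveSpectrum (piece n l V W)),
    fun a => mem_vanishingIdeal⟩
  have h1 : homog (semiDet (Module.finBasis ℂ V) w₀ l m) ∈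
      HomogeneousIdeal.irrelevant (piece n l V W) :=
    HomogeneousIdeal.mem_irrelevant_of_mem _ one_pos (toPiece _).2
  have h2 : homog (semiDet (Module.finBasis ℂ V) w₀ l m) ∈ vanishingIdeal l X := h h1
  rw [homog_mem_vanishingIdeal, semiDet_apply] at h2
  exact pow_ne_zero _ hm h2

theorem homog_semiDet_pow (m : ι → List (Fin n)) (k : ℕ) :
    homog ⟨(semiDet e w₀ l m).1 ^ k, semiDet_pow_mem m k⟩ = homog (semiDet e w₀ l m) ^ k := by
  refine Subtype.ext ?_
  change Polynomial.monomial k ((semiDet e w₀ l m).1 ^ k) =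
    Polynomial.monomial 1 (semiDet e w₀ l m).1 ^ k
  rw [Polynomial.monomial_pow, one_mul]

theorem IsNumerator.homog_mem (hl : 0 < l) {p : ProjectiveSpectrum (piece n l V W)}
    {m : ι → List (Fin n)} (hm : homog (semiDet e w₀ l m) ∉ p.asHomogeneousIdeal)
    {f F F' : Gam n V W} {N N' : ℕ} (h : IsNumerator e w₀ l m f N F)
    (h' : IsNumerator e w₀ l m f N' F') (hF : homog ⟨F, h.1⟩ ∈ p.asHomogeneousIdeal) :
    homog ⟨F', h'.1⟩ ∈ p.asHomogeneousIdeal := by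
  have key : homog (semiDet e w₀ l m) * (homog ⟨F, h.1⟩ * homog (semiDet e w₀ l m) ^ N') =
      homog (semiDet e w₀ l m) * (homog ⟨F', h'.1⟩ * homog (semiDet e w₀ l m) ^ N) := by
    rw [← homog_semiDet_pow, ← homog_semiDet_pow, ← homog_mk_mul, ← homog_mk_mul, ← homog_mk_mul,
      ← homog_mk_mul]
    exact homog_congr (by omega) (h.semiDet_mul_eq hl h')
  have h1 : homog (semiDet e w₀ l m) * (homog ⟨F', h'.1⟩ * homog (semiDet e w₀ l m) ^ N) ∈
      p.asHomogeneousIdeal.toIdeal := by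
    rw [← key]
    exact Ideal.mul_mem_left _ _ (Ideal.mul_mem_right _ _ hF)
  have h2 := (p.isPrime.mem_or_mem h1).resolve_left hm
  exact (p.isPrime.mem_or_mem h2).resolve_right fun h3 => hm (p.isPrime.mem_of_pow_mem _ h3)

/-- The prime ideal of the regular functions on the slice corresponding to a point of the GIT
quotient at which `d` does not vanish, pulled back to the ring of all regular functions. -/
def numeratorIdeal (hl : 0 < l) (hw : ∀ w : W, ∃ c : ℂ, c • w₀ = w)
    (p : ProjectiveSpectrum (piece n l V W)) {m : ι → List (Fin n)}
    (hm : homog (semiDet e w₀ l m) ∉ p.asHomogeneousIdeal) : Ideal (Gam n V W) where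
  carrier := {f | ∀ N F, ∀ h : IsNumerator e w₀ l m f N F, homog ⟨F, h.1⟩ ∈ p.asHomogeneousIdeal}
  zero_mem' N F h := by
    refine IsNumerator.homog_mem hl hm (N := 0) (F := 0) ⟨zero_mem _, fun _ _ => rfl⟩ h ?_
    have : homog (⟨0, zero_mem _⟩ : semiInvariants n l V W 0) = 0 :=
      Subtype.ext (Polynomial.monomial_zero_right 0)
    rw [this]
    exact zero_mem _
  add_mem' {f g} hf hg N F h := by
    obtain ⟨N₁, F₁, h₁⟩ := exists_isNumerator (e := e) hl hw m f
    obtain ⟨N₂, F₂, h₂⟩ := exists_isNumerator (e := e) hl hw m g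
    refine IsNumerator.homog_mem hl hm (h₁.add h₂) h ?_
    have : homog ⟨_, (h₁.add h₂).1⟩ = homog ⟨F₁, h₁.1⟩ * homog (semiDet e w₀ l m) ^ N₂ +
        homog ⟨F₂, h₂.1⟩ * homog (semiDet e w₀ l m) ^ N₁ := by
      rw [← homog_semiDet_pow, ← homog_semiDet_pow, ← homog_mk_mul,
        ← homog_mul ⟨F₂, h₂.1⟩ _ ⟨_, add_comm N₂ N₁ ▸ (h₂.raise N₁).1⟩ (add_comm N₂ N₁) rfl,
        ← homog_add]
      rfl
    rw [this]
    exact Ideal.add_mem _ (Ideal.mul_mem_right _ _ (hf _ _ h₁))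
      (Ideal.mul_mem_right _ _ (hg _ _ h₂))
  smul_mem' f g hg N F h := by
    obtain ⟨N₁, F₁, h₁⟩ := exists_isNumerator (e := e) hl hw m f
    obtain ⟨N₂, F₂, h₂⟩ := exists_isNumerator (e := e) hl hw m g
    refine IsNumerator.homog_mem hl hm (h₁.mul h₂) h ?_
    rw [homog_mul ⟨F₁, h₁.1⟩ ⟨F₂, h₂.1⟩ _ rfl rfl]
    exact Ideal.mul_mem_left _ _ (hg _ _ h₂)

theorem mem_numeratorIdeal_iff (hl : 0 < l) (hw : ∀ w : W, ∃ c : ℂ, c • w₀ = w)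
    (p : ProjectiveSpectrum (piece n l V W)) {m : ι → List (Fin n)}
    (hm : homog (semiDet e w₀ l m) ∉ p.asHomogeneousIdeal) {f F : Gam n V W} {N : ℕ}
    (h : IsNumerator e w₀ l m f N F) :
    f ∈ numeratorIdeal hl hw p hm ↔ homog ⟨F, h.1⟩ ∈ p.asHomogeneousIdeal :=
  ⟨fun hf => hf N F h, fun hF _ _ h' => h.homog_mem hl hm h' hF⟩

theorem numeratorIdeal_isPrime (hl : 0 < l) (hw : ∀ w : W, ∃ c : ℂ, c • w₀ = w)
    (p : ProjectiveSpectrum (piece n l V W)) {m : ι → List (Fin n)}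
    (hm : homog (semiDet e w₀ l m) ∉ p.asHomogeneousIdeal) :
    (numeratorIdeal hl hw p hm).IsPrime := by
  constructor
  · rw [Ne, Ideal.eq_top_iff_one, mem_numeratorIdeal_iff hl hw p hm
      (IsNumerator.of_semiInvariant (SetLike.GradedOne.one_mem : (1 : Gam n V W) ∈
        semiInvariants n l V W 0))]
    exact fun h => p.isPrime.ne_top ((Ideal.eq_top_iff_one _).2 h)
  · intro f g hfg
    obtain ⟨N₁, F₁, h₁⟩ := exists_isNumerator (e := e) hl hw m f
    obtain ⟨N₂, F₂, h₂⟩ := exists_isNumerator (e := e) hl hw m g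
    rw [mem_numeratorIdeal_iff hl hw p hm (h₁.mul h₂),
      homog_mul ⟨F₁, h₁.1⟩ ⟨F₂, h₂.1⟩ _ rfl rfl] at hfg
    rw [mem_numeratorIdeal_iff hl hw p hm h₁, mem_numeratorIdeal_iff hl hw p hm h₂]
    exact p.isPrime.mem_or_mem hfg

/-- Every point of a basic open subset of the GIT quotient specializes to the image of a stable
datum in that subset. -/
theorem exists_stable_specialization [FiniteDimensional ℂ V] (hl : 0 < l)
    (hw : ∀ w : W, ∃ c : ℂ, c • w₀ = w) (hw₀ : w₀ ≠ 0) (p : GITQuotient n l V W) {i : ℕ}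
    {c : semiInvariants n l V W i} (hc : homog c ∉ p.asHomogeneousIdeal) :
    ∃ X : Variety n V W, X.toDatum.IsStable ∧ c.1 X ≠ 0 ∧
      ∀ a ∈ p.asHomogeneousIdeal, ∀ i, a.1.coeff i X = 0 := by
  obtain ⟨m, hm⟩ := exists_semiDet_notMem hl hw hw₀ (Module.finBasis ℂ V) p
  have hcM : c.1 ∉ numeratorIdeal hl hw p hm := fun h =>
    hc ((mem_numeratorIdeal_iff hl hw p hm (IsNumerator.of_semiInvariant c.2)).1 h)
  have := numeratorIdeal_isPrime hl hw p hm
  obtain ⟨X, hX, hcX⟩ := exists_zero_of_notMem_prime hw hw₀ (numeratorIdeal hl hw p hm) hcM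
  have hd : (semiDet (Module.finBasis ℂ V) w₀ l m).1 - 1 ∈ numeratorIdeal hl hw p hm := by
    have h0 : IsNumerator (Module.finBasis ℂ V) w₀ l m
        ((semiDet (Module.finBasis ℂ V) w₀ l m).1 - 1) 0 0 :=
      ⟨zero_mem _, fun Y hY => by
        rw [Gam.sub_apply, semiDet_of_mem_slice hY, Gam.one_apply, sub_self, Gam.zero_apply]⟩
    rw [mem_numeratorIdeal_iff hl hw p hm h0]
    have : homog ⟨0, h0.1⟩ = 0 := Subtype.ext (Polynomial.monomial_zero_right 0)
    rw [this]
    exact zero_mem _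
  refine ⟨X, (isStable_iff (e := Module.finBasis ℂ V) hw X).2 ⟨m, fun h => ?_⟩, hcX,
    fun a ha i => hX _ ?_⟩
  · have := hX _ hd
    rw [Gam.sub_apply, semiDet_apply, h, zero_pow hl.ne', Gam.one_apply, zero_sub,
      neg_eq_zero] at this
    exact one_ne_zero this
  · rw [mem_numeratorIdeal_iff hl hw p hm (IsNumerator.of_semiInvariant (a.2 i))]
    exact (mem_asHomogeneousIdeal_iff p a).1 ha i

/-- A stable datum `Y` lies in the orbit of `X` if every semi-invariant that vanishes at `X`
vanishes at `Y`. -/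
theorem exists_eq_smul_of_vanishing (hl : 0 < l) (hw : ∀ w : W, ∃ c : ℂ, c • w₀ = w)
    (e : Module.Basis ι ℂ V) {X Y : Variety n V W} (hY : Y.toDatum.IsStable)
    (h : ∀ i, ∀ a : semiInvariants n l V W i, a.1 X = 0 → a.1 Y = 0) :
    ∃ g : LinearMap.GeneralLinearGroup ℂ V, Y = g • X := by
  obtain ⟨m, hmY⟩ := (isStable_iff (e := e) hw Y).1 hY
  have hmX : frameDet e w₀ m X ≠ 0 := fun hX => pow_ne_zero l hmY
    (h 1 (semiDet e w₀ l m) (by rw [semiDet_apply, hX, zero_pow hl.ne']))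
  obtain ⟨g₁, hg₁⟩ := exists_smul_mem_slice hmX
  obtain ⟨g₂, hg₂⟩ := exists_smul_mem_slice hmY
  have : g₂ • Y = g₁ • X := eq_of_mem_slice hl hw hg₂ fun f N F hF => by
    -- `F - f(g₁ • X) d ^ N` is a semi-invariant that vanishes at `g₁ • X`, as `d = 1` on the slice
    let a : semiInvariants n l V W N := ⟨F, hF.1⟩ - f (g₁ • X) •
      ⟨(semiDet e w₀ l m).1 ^ N, semiDet_pow_mem (e := e) (w₀ := w₀) m N⟩
    have ha : ∀ Z ∈ slice e w₀ m, a.1 Z = F Z - f (g₁ • X) := fun Z hZ => by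
      change F Z - f (g₁ • X) * ((semiDet e w₀ l m).1 Z) ^ N = _
      rw [semiDet_of_mem_slice hZ, one_pow, mul_one]
    have h1 : a.1 (g₁ • X) = 0 := by rw [ha _ hg₁, hF.2 _ hg₁, sub_self]
    have h2 : a.1 (g₂ • Y) = 0 := by
      rw [a.2 g₂ Y, h N a (apply_eq_zero_of_smul a.2 h1), mul_zero]
    rw [ha _ hg₂] at h2
    exact sub_eq_zero.1 h2
  exact ⟨g₂⁻¹ * g₁, by rw [mul_smul, ← this, inv_smul_smul]⟩

theorem mem_closure_singleton_iff {p q : GITQuotient n l V W} :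
    q ∈ closure {p} ↔ ∀ a ∈ p.asHomogeneousIdeal, a ∈ q.asHomogeneousIdeal :=
  (ProjectiveSpectrum.le_iff_mem_closure (𝒜 := piece n l V W) p q).symm

theorem eq_smul_of_isImage_of_le [FiniteDimensional ℂ V] (hl : 0 < l)
    (hw : ∀ w : W, ∃ c : ℂ, c • w₀ = w) {X Y : Variety n V W} (hY : Y.toDatum.IsStable)
    {p : GITQuotient n l V W} (hp : IsImage X p)
    (h : ∀ a ∈ p.asHomogeneousIdeal, ∀ i, a.1.coeff i Y = 0) :
    ∃ g : LinearMap.GeneralLinearGroup ℂ V, Y = g • X :=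
  exists_eq_smul_of_vanishing hl hw (Module.finBasis ℂ V) hY fun _ _ ha =>
    homog_mem_vanishingIdeal.1 (mem_vanishingIdeal.2 (h _ (hp.homog_mem_iff.2 ha)))

/-- The image of a datum is a closed point: any specialization of it specializes further to the
image of a stable datum, which then lies in the same orbit. -/
theorem IsImage.isClosed [FiniteDimensional ℂ V] (hl : 0 < l)
    (hw : ∀ w : W, ∃ c : ℂ, c • w₀ = w) (hw₀ : w₀ ≠ 0) {X : Variety n V W}
    {p : GITQuotient n l V W} (hp : IsImage X p) : IsClosed {p} := by
  refine isClosed_of_closure_subset fun q hq => ?_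
  rw [mem_closure_singleton_iff] at hq
  obtain ⟨i, -, c, hc⟩ := exists_homog_notMem q
  obtain ⟨Y, hY, -, hqY⟩ := exists_stable_specialization hl hw hw₀ q hc
  obtain ⟨g, rfl⟩ := eq_smul_of_isImage_of_le hl hw hY hp fun a ha => hqY a (hq a ha)
  exact IsImage.unique (X := g • X) (fun a => ⟨hqY a, fun ha => hq a ((hp.smul g a).2 ha)⟩)
    (hp.smul g)

theorem exists_isImage_of_isClosed [FiniteDimensional ℂ V] (hl : 0 < l)
    (hw : ∀ w : W, ∃ c : ℂ, c • w₀ = w) (hw₀ : w₀ ≠ 0) {p : GITQuotient n l V W}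
    (hp : IsClosed {p}) : ∃ X : Variety n V W, X.toDatum.IsStable ∧ IsImage X p := by
  obtain ⟨i, -, c, hc⟩ := exists_homog_notMem p
  obtain ⟨X, hX, -, hpX⟩ := exists_stable_specialization hl hw hw₀ p hc
  obtain ⟨q, hq⟩ := exists_isImage (l := l) hw hX
  have : q ∈ closure {p} := mem_closure_singleton_iff.2 fun a ha => (hq a).2 (hpX a ha)
  rw [hp.closure_eq] at this
  exact ⟨X, hX, Set.mem_singleton_iff.1 this ▸ hq⟩

end Frame

/-! ### The orbit space and the closed points -/

theorem isOpen_homog_notMem {i : ℕ} (c : semiInvariants n l V W i) :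
    IsOpen {p : GITQuotient n l V W | homog c ∉ p.asHomogeneousIdeal} :=
  ProjectiveSpectrum.isOpen_basicOpen (piece n l V W)

theorem exists_homog_of_isOpen {O : Set (GITQuotient n l V W)} (hO : IsOpen O)
    {p : GITQuotient n l V W} (hp : p ∈ O) :
    ∃ (i : ℕ) (c : semiInvariants n l V W i), homog c ∉ p.asHomogeneousIdeal ∧
      ∀ q : GITQuotient n l V W, homog c ∉ q.asHomogeneousIdeal → q ∈ O := by
  obtain ⟨_, ⟨a, rfl⟩, hpa, haO⟩ := (ProjectiveSpectrum.isTopologicalBasis_basic_opens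
    (piece n l V W)).exists_subset_of_mem_open (u := O) hp hO
  obtain ⟨i, hi⟩ := exists_homog_coeff_notMem (p := p) hpa
  exact ⟨i, _, hi, fun q hq => haO fun ha => hq ((mem_asHomogeneousIdeal_iff q a).1 ha i)⟩

theorem isOpen_apply_ne_zero (f : Gam n V W) : IsOpen {X : StableLocus n V W | f X.1 ≠ 0} :=
  (isOpen_ne_zero f.2).preimage continuous_subtype_val

/-- Open sets of stable data that are stable under the group are unions of sets `{b ≠ 0}`, with
`b` a semi-invariant: on a slice a regular function may be replaced with one of its numerators. -/
theorem exists_semiInvariant_of_isOpen [FiniteDimensional ℂ V] (hl : 0 < l) {w₀ : W}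
    (hw : ∀ w : W, ∃ c : ℂ, c • w₀ = w) {A : Set (StableLocus n V W)} (hA : IsOpen A)
    (hinv : ∀ X, ∀ g : LinearMap.GeneralLinearGroup ℂ V, g • X ∈ A ↔ X ∈ A)
    {X : StableLocus n V W} (hX : X ∈ A) :
    ∃ (i : ℕ) (b : semiInvariants n l V W i), b.1 X.1 ≠ 0 ∧
      ∀ Y : StableLocus n V W, b.1 Y.1 ≠ 0 → Y ∈ A := by
  let e := Module.finBasis ℂ V
  obtain ⟨m, hm⟩ := (isStable_iff (e := e) hw X.1).1 X.2
  obtain ⟨g, hg⟩ := exists_smul_mem_slice hm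
  obtain ⟨U, hU, rfl⟩ := isOpen_induced_iff.1 hA
  obtain ⟨f, hf, hfX, hfU⟩ := exists_regular_of_isOpen hU (show g • X.1 ∈ U from (hinv X g).2 hX)
  obtain ⟨N, F, hF⟩ := exists_isNumerator (e := e) hl hw m (⟨f, hf⟩ : Gam n V W)
  refine ⟨N + 1, ⟨F * (semiDet e w₀ l m).1, SetLike.mul_mem_graded hF.1 (semiDet e w₀ l m).2⟩,
    fun h => ?_, fun Y hY => ?_⟩
  · rw [Gam.mul_apply, semiDet_apply] at h
    have h1 : F (g • X.1) = 0 := by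
      rw [hF.1 g X.1, (mul_eq_zero.1 h).resolve_right (pow_ne_zero _ hm), mul_zero]
    exact hfX ((hF.2 _ hg).symm.trans h1)
  · rw [Gam.mul_apply, semiDet_apply] at hY
    obtain ⟨h, hh⟩ := exists_smul_mem_slice (ne_zero_pow hl.ne' (right_ne_zero_of_mul hY))
    refine (hinv Y h).1 (hfU (h • Y.1) fun h0 => left_ne_zero_of_mul hY ?_)
    exact apply_eq_zero_of_smul hF.1 ((hF.2 _ hh).trans h0)

section

variable [FiniteDimensional ℂ V] (hl : 0 < l) {w₀ : W} (hw : ∀ w : W, ∃ c : ℂ, c • w₀ = w)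
  (hw₀ : w₀ ≠ 0)

/-- The natural map from the orbit space of the stable locus to the closed points of the GIT
quotient. -/
def orbitMap : OrbitSpace n V W → ClosedPoints n l V W :=
  Quotient.lift (fun X : StableLocus n V W => ⟨(exists_isImage (l := l) hw X.2).choose,
    (exists_isImage (l := l) hw X.2).choose_spec.isClosed hl hw hw₀⟩) (by
    rintro X Y ⟨g, rfl⟩
    exact Subtype.ext ((exists_isImage (l := l) hw (g • Y).2).choose_spec.unique
      ((exists_isImage (l := l) hw Y.2).choose_spec.smul g)))

theorem isImage_orbitMap (X : StableLocus n V W) :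
    IsImage X.1 (orbitMap hl hw hw₀ (Quotient.mk _ X)).1 :=
  (exists_isImage (l := l) hw X.2).choose_spec

theorem orbitMap_bijective : Function.Bijective (orbitMap (n := n) hl hw hw₀ (V := V)) := by
  constructor
  · intro x y
    induction x using Quotient.inductionOn with | _ X
    induction y using Quotient.inductionOn with | _ Y
    intro h
    have hX := isImage_orbitMap hl hw hw₀ X
    have hY := isImage_orbitMap hl hw hw₀ Y
    rw [← h] at hY
    obtain ⟨g, hg⟩ := eq_smul_of_isImage_of_le hl hw Y.2 hX fun a ha => (hY a).1 ha
    exact (Quotient.sound (s := MulAction.orbitRel _ _) (a := Y) (b := X)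
      ⟨g, Subtype.ext hg.symm⟩).symm
  · intro p
    obtain ⟨X, hX, hp⟩ := exists_isImage_of_isClosed hl hw hw₀ p.2
    exact ⟨Quotient.mk _ ⟨X, hX⟩, Subtype.ext ((isImage_orbitMap hl hw hw₀ ⟨X, hX⟩).unique hp)⟩

/-- The natural map, as a homeomorphism. -/
def orbitHomeomorph : OrbitSpace n V W ≃ₜ ClosedPoints n l V W :=
  (Equiv.ofBijective (orbitMap hl hw hw₀) (orbitMap_bijective hl hw hw₀)).toHomeomorph (by
    intro s
    constructor
    · intro h
      have hA : IsOpen {X : StableLocus n V W | orbitMap hl hw hw₀ (Quotient.mk _ X) ∈ s} := h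
      refine isOpen_iff_forall_mem_open.2 fun p hp => ?_
      obtain ⟨x, rfl⟩ := (orbitMap_bijective hl hw hw₀).2 p
      induction x using Quotient.inductionOn with | _ X
      obtain ⟨i, b, hbX, hbA⟩ := exists_semiInvariant_of_isOpen hl hw hA (fun X g => by
        have : (Quotient.mk _ (g • X) : OrbitSpace n V W) = Quotient.mk _ X :=
          Quotient.sound (s := MulAction.orbitRel _ _) ⟨g, rfl⟩
        change orbitMap hl hw hw₀ _ ∈ s ↔ _
        rw [this]
        rfl) hp
      refine ⟨Subtype.val ⁻¹' {p : GITQuotient n l V W | homog b ∉ p.asHomogeneousIdeal}, ?_,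
        (isOpen_homog_notMem b).preimage continuous_subtype_val, ?_⟩
      · intro q hq
        obtain ⟨y, rfl⟩ := (orbitMap_bijective hl hw hw₀).2 q
        induction y using Quotient.inductionOn with | _ Y
        exact hbA Y fun h => hq ((isImage_orbitMap hl hw hw₀ Y).homog_mem_iff.2 h)
      · exact fun h => hbX ((isImage_orbitMap hl hw hw₀ X).homog_mem_iff.1 h)
    · intro h
      obtain ⟨O, hO, rfl⟩ := isOpen_induced_iff.1 h
      change IsOpen {X : StableLocus n V W | (orbitMap hl hw hw₀ (Quotient.mk _ X)).1 ∈ O}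
      refine isOpen_iff_forall_mem_open.2 fun X hX => ?_
      obtain ⟨i, c, hc, hcO⟩ := exists_homog_of_isOpen hO hX
      refine ⟨{Y | c.1 Y.1 ≠ 0}, fun Y (hY : c.1 Y.1 ≠ 0) => hcO _ fun h =>
        hY ((isImage_orbitMap hl hw hw₀ Y).homog_mem_iff.1 h), isOpen_apply_ne_zero c.1,
        fun h => hc ((isImage_orbitMap hl hw hw₀ X).homog_mem_iff.2 h)⟩)

theorem isImage_orbitHomeomorph (X : StableLocus n V W) :
    IsImage X.1 (orbitHomeomorph hl hw hw₀ (Quotient.mk _ X)).1 :=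
  isImage_orbitMap hl hw hw₀ X

end

/-! ### Sections of the structure sheaf as families of fractions -/

/-- The fraction `a / b` of two semi-invariants of the same weight, in the local ring at a point
where `b` does not vanish. -/
def frac {i : ℕ} (a b : semiInvariants n l V W i) (q : GITQuotient n l V W)
    (hb : homog b ∉ q.asHomogeneousIdeal) :
    HomogeneousLocalization.AtPrime (piece n l V W) q.asHomogeneousIdeal.toIdeal :=
  HomogeneousLocalization.mk ⟨i, toPiece a, toPiece b, hb⟩

/-- The product of two semi-invariants. -/
abbrev semiMul {i j : ℕ} (f : semiInvariants n l V W i) (g : semiInvariants n l V W j) :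
    semiInvariants n l V W (i + j) :=
  ⟨f.1 * g.1, SetLike.mul_mem_graded f.2 g.2⟩

theorem homog_semiMul_notMem {i j : ℕ} {f : semiInvariants n l V W i}
    {g : semiInvariants n l V W j} {q : GITQuotient n l V W} :
    homog (semiMul f g) ∉ q.asHomogeneousIdeal ↔
      homog f ∉ q.asHomogeneousIdeal ∧ homog g ∉ q.asHomogeneousIdeal := by
  rw [homog_mk_mul, ← not_or]
  exact (ProjectiveSpectrum.isPrime q).mul_mem_iff_mem_or_mem.not

theorem frac_eq_frac_iff {i j : ℕ} {a b : semiInvariants n l V W i}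
    {a' b' : semiInvariants n l V W j} {q : GITQuotient n l V W}
    {hb : homog b ∉ q.asHomogeneousIdeal} {hb' : homog b' ∉ q.asHomogeneousIdeal} :
    frac a b q hb = frac a' b' q hb' ↔ ∃ (k : ℕ) (c : semiInvariants n l V W k),
      homog c ∉ q.asHomogeneousIdeal ∧
        ∀ X, c.1 X * (b'.1 X * a.1 X) = c.1 X * (b.1 X * a'.1 X) := by
  rw [← (HomogeneousLocalization.val_injective _).eq_iff, frac, frac,
    HomogeneousLocalization.val_mk, HomogeneousLocalization.val_mk, Localization.mk_eq_mk_iff,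
    Localization.r_iff_exists]
  change (∃ c : q.asHomogeneousIdeal.toIdeal.primeCompl,
    c.1 * (homog b' * homog a) = c.1 * (homog b * homog a')) ↔ _
  rw [← homog_mk_mul, ← homog_mk_mul]
  constructor
  · rintro ⟨⟨c, hc⟩, h⟩
    obtain ⟨k, hk⟩ := exists_homog_coeff_notMem (p := q) hc
    refine ⟨k, _, hk, fun X => ?_⟩
    have h1 : (c.1 * Polynomial.monomial (j + i) (b'.1 * a.1)).coeff (k + (j + i)) =
        (c.1 * Polynomial.monomial (i + j) (b.1 * a'.1)).coeff (k + (i + j)) := by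
      rw [add_comm i j]
      rw [homog_congr (f := ⟨b.1 * a'.1, _⟩) (g := ⟨b.1 * a'.1, add_comm i j ▸
        SetLike.mul_mem_graded b.2 a'.2⟩) (add_comm i j) rfl] at h
      exact congrArg (fun P : SemiInvariantRing n l V W => P.1.coeff (k + (j + i))) h
    rw [Polynomial.coeff_mul_monomial, Polynomial.coeff_mul_monomial] at h1
    exact congrArg (fun f : Gam n V W => f X) h1
  · rintro ⟨k, c, hc, h⟩
    refine ⟨⟨homog c, hc⟩, ?_⟩
    change homog c * _ = homog c * _
    rw [← homog_mk_mul, ← homog_mk_mul]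
    exact homog_congr (by omega) (Gam.ext h)

/-- The germ of a section at a point, in the homogeneous localization. -/
def sectionGerm {U : (GITQuotient n l V W).Opens} (s : Γ(GITQuotient n l V W, U))
    (q : GITQuotient n l V W) (hq : q ∈ U) :
    HomogeneousLocalization.AtPrime (piece n l V W) q.asHomogeneousIdeal.toIdeal :=
  (Proj.stalkIso (piece n l V W) q).hom ((GITQuotient n l V W).presheaf.germ U q hq s)

/-- A section of the structure sheaf of `Proj` over an open set, as a family of elements of the
local rings. -/
def sectionFamily {U : (GITQuotient n l V W).Opens} (s : Γ(GITQuotient n l V W, U)) :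
    (ProjectiveSpectrum.Proj.structureSheaf (piece n l V W)).1.obj (Opposite.op U) := s

theorem sectionGerm_eq {U : (GITQuotient n l V W).Opens} (s : Γ(GITQuotient n l V W, U))
    (q : GITQuotient n l V W) (hq : q ∈ U) :
    sectionGerm s q hq = (sectionFamily s).1 ⟨q, hq⟩ :=
  Proj.stalkIso'_germ (piece n l V W) U q hq s

theorem section_ext {U : (GITQuotient n l V W).Opens} {s t : Γ(GITQuotient n l V W, U)}
    (h : ∀ q hq, sectionGerm s q hq = sectionGerm t q hq) : s = t := by
  refine Subtype.ext (a1 := sectionFamily s) (a2 := sectionFamily t) (funext fun q => ?_)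
  exact (sectionGerm_eq s q.1 q.2).symm.trans ((h q.1 q.2).trans (sectionGerm_eq t q.1 q.2))

theorem exists_sectionGerm_eq_frac {U : (GITQuotient n l V W).Opens}
    (s : Γ(GITQuotient n l V W, U)) (q : GITQuotient n l V W) (hq : q ∈ U) :
    ∃ (i : ℕ) (a b : semiInvariants n l V W i) (j : ℕ) (c : semiInvariants n l V W j),
      homog c ∉ q.asHomogeneousIdeal ∧ ∀ q' : GITQuotient n l V W, homog c ∉ q'.asHomogeneousIdeal →
        ∃ (hU : q' ∈ U) (hb : homog b ∉ q'.asHomogeneousIdeal),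
          sectionGerm s q' hU = frac a b q' hb := by
  obtain ⟨O, hqO, hOU, i, a, b, hb, h⟩ := (sectionFamily s).2 ⟨q, hq⟩
  obtain ⟨j, c, hc, hcO⟩ := exists_homog_of_isOpen O.2 hqO
  refine ⟨i, ⟨a.1.1.coeff i, a.1.2 i⟩, ⟨b.1.1.coeff i, b.1.2 i⟩, j, c, hc, fun q' hq' => ?_⟩
  have hb' := hb ⟨q', hcO q' hq'⟩
  refine ⟨hOU.le (hcO q' hq'), by rwa [homog_coeff], ?_⟩
  rw [sectionGerm_eq]
  refine (h ⟨q', hcO q' hq'⟩).trans ?_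
  simp only [frac, toPiece_coeff]

theorem exists_section {U : (GITQuotient n l V W).Opens}
    (φ : ∀ q : GITQuotient n l V W, q ∈ U →
      HomogeneousLocalization.AtPrime (piece n l V W) q.asHomogeneousIdeal.toIdeal)
    (h : ∀ q ∈ U, ∃ (i : ℕ) (a b : semiInvariants n l V W i) (j : ℕ) (c : semiInvariants n l V W j),
      homog c ∉ q.asHomogeneousIdeal ∧ ∀ q' : GITQuotient n l V W, homog c ∉ q'.asHomogeneousIdeal →
        ∃ (hU : q' ∈ U) (hb : homog b ∉ q'.asHomogeneousIdeal), φ q' hU = frac a b q' hb) :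
    ∃ s : Γ(GITQuotient n l V W, U), ∀ q hq, sectionGerm s q hq = φ q hq := by
  let s : (ProjectiveSpectrum.Proj.structureSheaf (piece n l V W)).1.obj (Opposite.op U) :=
    ⟨fun q => φ q.1 q.2, fun q => by
      obtain ⟨i, a, b, j, c, hc, hφ⟩ := h q.1 q.2
      exact ⟨ProjectiveSpectrum.basicOpen (piece n l V W) (homog c), hc,
        homOfLE fun q' hq' => (hφ q' hq').1, i, toPiece a, toPiece b,
        fun q' => (hφ q'.1 q'.2).2.1, fun q' => (hφ q'.1 q'.2).2.2⟩⟩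
  exact ⟨s, fun q hq => sectionGerm_eq (U := U) s q hq⟩

/-! ### Sections and invariant regular functions -/

section Value

variable {U : (GITQuotient n l V W).Opens} {s : Γ(GITQuotient n l V W, U)}
  {p : GITQuotient n l V W} {hp : p ∈ U} {X : Variety n V W}

theorem hasValue_iff {v : ℂ} : HasValue s p hp X v ↔
    ∃ (i : ℕ) (a b : semiInvariants n l V W i) (hb : homog b ∉ p.asHomogeneousIdeal),
      sectionGerm s p hp = frac a b p hb ∧ b.1 X ≠ 0 ∧ v = a.1 X / b.1 X :=
  Iff.rfl

theorem IsImage.hasValue_iff_of_eq_frac (hX : IsImage X p) {i : ℕ} {a b : semiInvariants n l V W i}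
    {hb : homog b ∉ p.asHomogeneousIdeal} (h : sectionGerm s p hp = frac a b p hb) {v : ℂ} :
    HasValue s p hp X v ↔ v = a.1 X / b.1 X := by
  have hbX : b.1 X ≠ 0 := fun h0 => hb (hX.homog_mem_iff.2 h0)
  rw [hasValue_iff]
  refine ⟨?_, fun hv => ⟨i, a, b, hb, h, hbX, hv⟩⟩
  rintro ⟨i', a', b', hb', h', hbX', rfl⟩
  rw [h, frac_eq_frac_iff] at h'
  obtain ⟨k, c, hc, hc'⟩ := h'
  have hcX : c.1 X ≠ 0 := fun h0 => hc (hX.homog_mem_iff.2 h0)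
  have := mul_left_cancel₀ hcX (hc' X)
  rw [div_eq_div_iff hbX' hbX, mul_comm, ← this, mul_comm]

theorem IsImage.exists_hasValue (hX : IsImage X p) : ∃ v, HasValue s p hp X v := by
  obtain ⟨i, a, b, j, c, hc, h⟩ := exists_sectionGerm_eq_frac s p hp
  obtain ⟨hU, hb, h'⟩ := h p hc
  exact ⟨_, (hX.hasValue_iff_of_eq_frac h').2 rfl⟩

theorem IsImage.hasValue_unique (hX : IsImage X p) {v v' : ℂ} (h : HasValue s p hp X v)
    (h' : HasValue s p hp X v') : v = v' := by
  obtain ⟨i, a, b, j, c, hc, hs⟩ := exists_sectionGerm_eq_frac s p hp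
  obtain ⟨hU, hb, hs'⟩ := hs p hc
  rw [hX.hasValue_iff_of_eq_frac hs'] at h h'
  rw [h, h']

theorem HasValue.of_smul {g : LinearMap.GeneralLinearGroup ℂ V} {v : ℂ}
    (h : HasValue s p hp (g • X) v) : HasValue s p hp X v := by
  obtain ⟨i, a, b, hb, h, hbX, rfl⟩ := h
  rw [b.2 g X] at hbX
  refine ⟨i, a, b, hb, h, right_ne_zero_of_mul hbX, ?_⟩
  rw [a.2 g X, b.2 g X, mul_div_mul_left _ _ (left_ne_zero_of_mul hbX)]

theorem HasValue.congr_point {q : GITQuotient n l V W} (hq : q ∈ U) (hpq : p = q) {v : ℂ}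
    (h : HasValue s p hp X v) : HasValue s q hq X v := by
  subst hpq
  exact h

end Value

section

variable {π : StableLocus n V W → GITQuotient n l V W} {U : (GITQuotient n l V W).Opens}

theorem existsUnique_function (hπ : ∀ X, IsImage X.1 (π X))
    (s : Γ(GITQuotient n l V W, U)) :
    ∃! f : {X : StableLocus n V W | π X ∈ U} → ℂ, (IsRegular f ∧ IsInvariant f) ∧
      ∀ X, HasValue s (π X.1) X.2 X.1.1 (f X) := by
  choose f hf using fun X : {X : StableLocus n V W | π X ∈ U} =>
    (hπ X.1).exists_hasValue (s := s) (hp := X.2)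
  refine ⟨f, ⟨⟨fun X => ?_, fun X Y h => ?_⟩, hf⟩, fun f' hf' => funext fun X =>
    (hπ X.1).hasValue_unique (hf'.2 X) (hf X)⟩
  · obtain ⟨i, a, b, j, c, hc, h⟩ := exists_sectionGerm_eq_frac s (π X.1) X.2
    obtain ⟨-, hb, -⟩ := h _ hc
    refine ⟨a.1 * c.1, b.1 * c.1, ?_, fun Y hY => ?_⟩
    · exact mul_ne_zero (fun h0 => hb ((hπ X.1).homog_mem_iff.2 h0))
        fun h0 => hc ((hπ X.1).homog_mem_iff.2 h0)
    · have hcY : c.1 Y.1.1 ≠ 0 := right_ne_zero_of_mul hY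
      obtain ⟨_, hb', h'⟩ := h (π Y.1) fun h0 => hcY ((hπ Y.1).homog_mem_iff.1 h0)
      rw [((hπ Y.1).hasValue_iff_of_eq_frac h').1 (hf Y), Gam.mul_apply, Gam.mul_apply,
        mul_div_mul_right _ _ hcY]
  · obtain ⟨g, hg⟩ := h
    have h1 : π Y.1 = π X.1 := (hg ▸ hπ Y.1 : IsImage (g • X.1.1) (π Y.1)).unique ((hπ X.1).smul g)
    have h2 : HasValue s (π Y.1) Y.2 (g • X.1.1) (f Y) := by
      have := hf Y
      rwa [congrArg Subtype.val hg] at this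
    exact (hπ X.1).hasValue_unique (h2.of_smul.congr_point X.2 h1) (hf X)

variable [FiniteDimensional ℂ V]

/-- Fractions that agree at the stable data where `c ≠ 0` agree at all points where `c ≠ 0`: some
determinantal semi-invariant is nonzero at the point, and it vanishes at the unstable data. -/
theorem frac_eq_frac_of_forall_stable (hl : 0 < l) {w₀ : W}
    (hw : ∀ w : W, ∃ c : ℂ, c • w₀ = w) (hw₀ : w₀ ≠ 0)
    {i i' j : ℕ} {a b : semiInvariants n l V W i}
    {a' b' : semiInvariants n l V W i'} (c : semiInvariants n l V W j) {q : GITQuotient n l V W}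
    (hc : homog c ∉ q.asHomogeneousIdeal) {hb : homog b ∉ q.asHomogeneousIdeal}
    {hb' : homog b' ∉ q.asHomogeneousIdeal}
    (h : ∀ Y : StableLocus n V W, c.1 Y.1 ≠ 0 → b'.1 Y.1 * a.1 Y.1 = b.1 Y.1 * a'.1 Y.1) :
    frac a b q hb = frac a' b' q hb' := by
  obtain ⟨m, hm⟩ := exists_semiDet_notMem hl hw hw₀ (Module.finBasis ℂ V) q
  refine frac_eq_frac_iff.2 ⟨_, semiMul c (semiDet _ w₀ l m), homog_semiMul_notMem.2 ⟨hc, hm⟩,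
    fun X => ?_⟩
  rw [Gam.mul_apply, semiDet_apply]
  by_cases hX : c.1 X * frameDet (Module.finBasis ℂ V) w₀ m X ^ l = 0
  · rw [hX, zero_mul, zero_mul]
  · rw [h ⟨X, (isStable_iff hw X).2 ⟨m, ne_zero_pow hl.ne' (right_ne_zero_of_mul hX)⟩⟩
      (left_ne_zero_of_mul hX)]

/-- An invariant regular function is, near the data over a given point, a fraction of two
semi-invariants: on a slice numerator and denominator of a local expression may be replaced with
semi-invariants. -/
theorem exists_frac_of_isInvariant (hπ : ∀ X, IsImage X.1 (π X)) (hl : 0 < l) {w₀ : W}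
    (hw : ∀ w : W, ∃ c : ℂ, c • w₀ = w) (hw₀ : w₀ ≠ 0)
    {f : {X : StableLocus n V W | π X ∈ U} → ℂ} (hf : IsRegular f)
    (hinv : IsInvariant f) {q : GITQuotient n l V W} (hq : q ∈ U) :
    ∃ (i : ℕ) (a b : semiInvariants n l V W i) (j : ℕ) (c : semiInvariants n l V W j),
      homog c ∉ q.asHomogeneousIdeal ∧
      (∀ q' : GITQuotient n l V W, homog c ∉ q'.asHomogeneousIdeal →
        q' ∈ U ∧ homog b ∉ q'.asHomogeneousIdeal) ∧
      ∀ Y, c.1 Y.1.1 ≠ 0 → f Y = a.1 Y.1.1 / b.1 Y.1.1 := by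
  let e := Module.finBasis ℂ V
  obtain ⟨k, c₀, hc₀, hcU⟩ := exists_homog_of_isOpen U.2 hq
  obtain ⟨X, hX, hcX, hqX⟩ := exists_stable_specialization hl hw hw₀ q hc₀
  have hnotMem : ∀ {i : ℕ} {b : semiInvariants n l V W i}, b.1 X ≠ 0 →
      homog b ∉ q.asHomogeneousIdeal := fun hb h =>
    hb (homog_mem_vanishingIdeal.1 (mem_vanishingIdeal.2 (hqX _ h)))
  have hXU : ∀ Y : StableLocus n V W, c₀.1 Y.1 ≠ 0 → π Y ∈ U := fun Y hY =>
    hcU _ fun h => hY ((hπ Y).homog_mem_iff.1 h)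
  have hmove : ∀ (g : LinearMap.GeneralLinearGroup ℂ V) (Y : StableLocus n V W), π Y ∈ U →
      π (g • Y) ∈ U := fun g Y hY => by
    rwa [(hπ (g • Y)).unique ((hπ Y).smul g)]
  obtain ⟨m, hm⟩ := (isStable_iff (e := e) hw X).1 hX
  obtain ⟨g, hg⟩ := exists_smul_mem_slice hm
  obtain ⟨P, Q, hQ, hPQ⟩ := hf ⟨g • ⟨X, hX⟩, hmove g _ (hXU ⟨X, hX⟩ hcX)⟩
  obtain ⟨N, A', hA'⟩ := exists_isNumerator (e := e) hl hw m P
  obtain ⟨N', B', hB'⟩ := exists_isNumerator (e := e) hl hw m Q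
  obtain ⟨A, hA⟩ : ∃ A : semiInvariants n l V W (N + N'), IsNumerator e w₀ l m P (N + N') A.1 :=
    ⟨⟨_, (hA'.raise N').1⟩, hA'.raise N'⟩
  obtain ⟨B, hB⟩ : ∃ B : semiInvariants n l V W (N + N'), IsNumerator e w₀ l m Q (N + N') B.1 :=
    have hmem := add_comm N' N ▸ (hB'.raise N).1
    ⟨⟨_, hmem⟩, hmem, (hB'.raise N).2⟩
  have hBX : B.1 X ≠ 0 := fun h => hQ (by
    refine (hB.2 _ hg).symm.trans ?_
    rw [B.2 g X, h, mul_zero])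
  have hdX : (semiDet e w₀ l m).1 X ≠ 0 := by
    rw [semiDet_apply]
    exact pow_ne_zero _ hm
  refine ⟨_, A, B, _, semiMul (semiMul c₀ B) (semiDet e w₀ l m), ?_, fun q' hq' => ?_,
    fun Y hY => ?_⟩
  · exact homog_semiMul_notMem.2 ⟨homog_semiMul_notMem.2 ⟨hc₀, hnotMem hBX⟩, hnotMem hdX⟩
  · obtain ⟨h1, h2⟩ := homog_semiMul_notMem.1 (homog_semiMul_notMem.1 hq').1
    exact ⟨hcU q' h1, h2⟩
  · rw [Gam.mul_apply, Gam.mul_apply, semiDet_apply] at hY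
    have hBY : B.1 Y.1.1 ≠ 0 := right_ne_zero_of_mul (left_ne_zero_of_mul hY)
    obtain ⟨h, hh⟩ := exists_smul_mem_slice (ne_zero_pow hl.ne' (right_ne_zero_of_mul hY))
    have hχ : (character l V h : ℂ) ^ (N + N') ≠ 0 := pow_ne_zero _ (Units.ne_zero _)
    have hBh := B.2 h Y.1.1
    have hQh : Q (h • Y.1.1) ≠ 0 := by
      rw [← hB.2 _ hh, hBh]
      exact mul_ne_zero hχ hBY
    rw [← hinv Y ⟨h • Y.1, hmove h _ Y.2⟩ ⟨h, rfl⟩, hPQ _ hQh]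
    change P (h • Y.1.1) / Q (h • Y.1.1) = _
    rw [← hA.2 _ hh, ← hB.2 _ hh, A.2 h, hBh, mul_div_mul_left _ _ hχ]

theorem existsUnique_section (hπ : ∀ X, IsImage X.1 (π X)) (hl : 0 < l) {w₀ : W}
    (hw : ∀ w : W, ∃ c : ℂ, c • w₀ = w) (hw₀ : w₀ ≠ 0)
    {f : {X : StableLocus n V W | π X ∈ U} → ℂ} (hf : IsRegular f)
    (hinv : IsInvariant f) :
    ∃! s : Γ(GITQuotient n l V W, U), ∀ X, HasValue s (π X.1) X.2 X.1.1 (f X) := by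
  have hne : ∀ {i : ℕ} {b : semiInvariants n l V W i} {Y : StableLocus n V W},
      homog b ∉ (π Y).asHomogeneousIdeal ↔ b.1 Y.1 ≠ 0 := (hπ _).homog_mem_iff.not
  apply existsUnique_of_exists_of_unique
  · choose i a b j c hc hU hval using fun (q : GITQuotient n l V W) (hq : q ∈ U) =>
      exists_frac_of_isInvariant hπ hl hw hw₀ hf hinv hq
    obtain ⟨s, hs⟩ := exists_section (U := U)
      (fun q hq => frac (a q hq) (b q hq) q (hU q hq q (hc q hq)).2) fun q hq =>
        ⟨_, a q hq, b q hq, _, c q hq, hc q hq, fun q' hq' => ⟨(hU q hq q' hq').1,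
          (hU q hq q' hq').2, frac_eq_frac_of_forall_stable hl hw hw₀
            (semiMul (c q hq) (c q' (hU q hq q' hq').1))
            (homog_semiMul_notMem.2 ⟨hq', hc q' (hU q hq q' hq').1⟩) fun Y hY => by
          have hq'U := (hU q hq q' hq').1
          have h1 := left_ne_zero_of_mul hY
          have h2 := right_ne_zero_of_mul hY
          have hY1 := hU q hq (π Y) (hne.2 h1)
          have hY2 := hU q' hq'U (π Y) (hne.2 h2)
          have h3 := (hval q hq ⟨Y, hY1.1⟩ h1).symm.trans (hval q' hq'U ⟨Y, hY1.1⟩ h2)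
          rw [div_eq_div_iff (hne.1 hY1.2) (hne.1 hY2.2)] at h3
          rw [mul_comm, ← h3, mul_comm]⟩⟩
    exact ⟨s, fun X => ((hπ X.1).hasValue_iff_of_eq_frac (hs _ X.2)).2
      (hval _ X.2 X (hne.1 (hc _ X.2)))⟩
  · intro s t hs ht
    refine section_ext fun q hq => ?_
    obtain ⟨i, a, b, j, c, hc, h⟩ := exists_sectionGerm_eq_frac s q hq
    obtain ⟨i', a', b', j', c', hc', h'⟩ := exists_sectionGerm_eq_frac t q hq
    obtain ⟨_, hb, hsq⟩ := h q hc
    obtain ⟨_, hb', htq⟩ := h' q hc'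
    rw [hsq, htq]
    refine frac_eq_frac_of_forall_stable hl hw hw₀ (semiMul c c')
      (homog_semiMul_notMem.2 ⟨hc, hc'⟩) fun Y hY => ?_
    obtain ⟨hYU, hbY, hsY⟩ := h (π Y) (hne.2 (left_ne_zero_of_mul hY))
    obtain ⟨_, hbY', htY⟩ := h' (π Y) (hne.2 (right_ne_zero_of_mul hY))
    have h3 := (((hπ Y).hasValue_iff_of_eq_frac hsY).1 (hs ⟨Y, hYU⟩)).symm.trans
      (((hπ Y).hasValue_iff_of_eq_frac htY).1 (ht ⟨Y, hYU⟩))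
    rw [div_eq_div_iff (hne.1 hbY) (hne.1 hbY')] at h3
    rw [mul_comm, h3, mul_comm]

end

end ADHM

end

theorem mainTheorem11 (n l : ℕ) (hl : 0 < l) (V W : Type*)
    [AddCommGroup V] [Module ℂ V] [FiniteDimensional ℂ V]
    [AddCommGroup W] [Module ℂ W] (hW : Module.finrank ℂ W = 1) :
    -- the orbit of `(X, z)`, `z ≠ 0`, is closed in `𝒱(n, c) × ℂ` if and only if `X` is stable
    (∀ (X : ADHM.Variety n V W) (z : ℂ), z ≠ 0 →
      (IsClosed (MulAction.orbit (LinearMap.GeneralLinearGroup ℂ V)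
          (⟨X, z⟩ : ADHM.Linearized n l V W)) ↔ X.toDatum.IsStable)) ∧
    -- the GIT quotient is the orbit space of the stable locus: as a topological space, through
    -- the natural map,
    ∃ e : ADHM.OrbitSpace n V W ≃ₜ ADHM.ClosedPoints n l V W,
      (∀ X : ADHM.StableLocus n V W,
        ADHM.IsImage X.1 (e (Quotient.mk _ X)).1) ∧
      -- and as a ringed space: the sections of its structure sheaf over an open set are the
      -- invariant regular functions on the preimage of the open set in the stable locus
      ∀ U : (ADHM.GITQuotient n l V W).Opens,
        (∀ s : Γ(ADHM.GITQuotient n l V W, U),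
          ∃! f : {X : ADHM.StableLocus n V W | (e (Quotient.mk _ X)).1 ∈ U} → ℂ,
            (ADHM.IsRegular f ∧ ADHM.IsInvariant f) ∧
              ∀ X, ADHM.HasValue s (e (Quotient.mk _ X.1)).1 X.2 X.1.1 (f X)) ∧
        (∀ f : {X : ADHM.StableLocus n V W | (e (Quotient.mk _ X)).1 ∈ U} → ℂ,
          ADHM.IsRegular f → ADHM.IsInvariant f →
            ∃! s : Γ(ADHM.GITQuotient n l V W, U),
              ∀ X, ADHM.HasValue s (e (Quotient.mk _ X.1)).1 X.2 X.1.1 (f X)) := by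
  obtain ⟨w₀, hw₀, hw⟩ := finrank_eq_one_iff'.1 hW
  exact ⟨fun X z hz => ADHM.isClosed_orbit_iff hl hw X hz, ADHM.orbitHomeomorph hl hw hw₀,
    ADHM.isImage_orbitHomeomorph hl hw hw₀, fun U =>
    ⟨ADHM.existsUnique_function (ADHM.isImage_orbitHomeomorph hl hw hw₀),
      fun _ => ADHM.existsUnique_section (ADHM.isImage_orbitHomeomorph hl hw hw₀) hl hw hw₀⟩⟩
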